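/- **Lemma (sufficient conditions for misspecified LAN).** Let $\Theta\subseteq\mathbb R^d$, let $\{p_\theta:\theta\in\Theta\}$ be probability densities with respect to a $\sigma$-finite measure $\mu$ on $\mathcal X$, let $\theta_0\in\Theta$, $P_{\theta_0}=p_{\theta_0}\,d\mu$, let $X^{(n)}=(X_1,\dots,X_n)\sim P_{\theta_0}^n$ be i.i.d., and write $p^{(n)}_\theta(X^{(n)})=\prod_{i=1}^n p_\theta(X_i)$, $\mathbb P_n f=\frac1n\sum_{i=1}^n f(X_i)$. Let $Z_n\sim Q_n$ be latent data independent of $X^{(n)}$ ($Q_n$ may be a point mass, in which case the latent data are fixed), and let $\hat D_n^\theta:\mathcal X\to(0,1)$ be a classifier trained on $(X^{(n)},Z_n)$. With the oracle classifier $D_\theta=p_{\theta_0}/(p_{\theta_0}+p_\theta)$ put $$u_\theta=\sum_{i=1}^n\Bigl(\log\tfrac{1-\hat D_n^\theta}{1-D_\theta}-\log\tfrac{\hat D_n^\theta}{D_\theta}\Bigr)(X_i),\qquad \tilde p^{(n)}_\theta=\frac{p_\theta^{(n)}e^{u_\theta}}{C_\theta},\qquad C_\theta=\int p_\theta^{(n)}e^{u_\theta}\,d\mu^n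 ,$$ where $p_\theta^{(n)}e^{u_\theta}$ is understood as $p_{\theta_0}^{(n)}\prod_{i=1}^n\frac{1-\hat D_n^\theta(X_i)}{\hat D_n^\theta(X_i)}$ (the same thing wherever $u_\theta$ is finite), and $C_\theta$ integrates over the observed sample with $Z_n$ held fixed. Let $\theta^*\in\Theta$ and let $U\subseteq\Theta$ be an open neighbourhood of $\theta^*$ in $\mathbb R^d$ such that, for every $n$ and $Q_n$-almost every value of $Z_n$, $C_\theta<\infty$ for all $\theta\in U$. "In probability" refers to (outer) probability under $P_{\theta_0}^{n}\otimes Q_n$. Assume: 1. for $P_{\theta_0}$-almost every $x$, $p_\theta(x)>0$ for all $\theta\in U$, and $\theta\mapsto\log p_\theta(x)$ is differentiable at $\theta^*$ with gradient $\dot\ell_{\theta^*}(x)$; 2. there is $m_{\theta^*}\in L^2(P_{\theta_0})$ such that, for $P_{\theta_0}$-almost every $x$, $\bigl|\log\frac{p_{\theta_1}(x)}{p_{\theta_2}(x)}\bigr|\le m_{\theta^*}(x)\|\theta_1-\theta_2\|$ for all $\theta_1,\theta_2\in U$; 3. for a nonsingular matrix $V_{\theta^*}$, as $\theta\to\theta^*$,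 $$P_{\theta_0}\log\frac{p_\theta}{p_{\theta^*}}=P_{\theta_0}\dot\ell_{\theta^*}'(\theta-\theta^*)+\tfrac12(\theta-\theta^*)'V_{\theta^*}(\theta-\theta^*)+o(\|\theta-\theta^*\|^2);$$ 4. for random vectors $u^*=u^*(X^{(n)},Z_n)$, $u_{\theta^*+h/\sqrt n}-u_{\theta^*}=\frac1{\sqrt n}h'u^*+o_P(1)$ uniformly in $h$ over every compact subset of $\mathbb R^d$; 5. for vectors $\dot C_{\theta^*}=\dot C_{n,\theta^*}$ (which may depend on $n$ and $Z_n$), $\log\frac{C_{\theta^*+h/\sqrt n}}{C_{\theta^*}}=\frac1{\sqrt n}h'\dot C_{\theta^*}+o_P(1)$ uniformly in $h$ over every compact subset of $\mathbb R^d$ (an $o(1)$ if the latent data are fixed). Then, for every compact $K\subset\mathbb R^d$, $$\sup_{h\in K}\Bigl|\log\frac{\tilde p^{(n)}_{\theta^*+h/\sqrt n}}{\tilde p^{(n)}_{\theta^*}}-h'V_{\theta^*}\tilde\Delta_{n,\theta^*}-\tfrac12h'V_{\theta^*}h\Bigr|\to0\quad\text{in probability},$$ $$\text{where}\quad \tilde\Delta_{n,\theta^*}=V_{\theta^*}^{-1}\Bigl[-\frac{\dot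 C_{\theta^*}}{\sqrt n}+\sqrt n\,\mathbb P_n\dot\ell_{\theta^*}+\frac{u^*}{\sqrt n}\Bigr]\ \text{ is a random vector.}$$ That is, the misspecified LAN condition holds with rate $\varepsilon_n^*=1/\sqrt n$, $\tilde V_{\theta^*}=V_{\theta^*}$ and this centering. -/

import Mathlib

open MeasureTheory Filter Topology

noncomputable section

/-- `ℝ^d` with the Euclidean norm. -/
abbrev Euc (d : ℕ) : Type := EuclideanSpace ℝ (Fin d)

/-- `p θ` is, for each `θ ∈ Θ`, a probability density with respect to `μ`. -/
structure IsDensityFamily {X : Type*} [MeasurableSpace X] {d : ℕ} (μ : Measure X)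
    (Θ : Set (Euc d)) (p : Euc d → X → ℝ) : Prop where
  measurable : ∀ θ ∈ Θ, Measurable (p θ)
  nonneg : ∀ θ ∈ Θ, ∀ x, 0 ≤ p θ x
  lintegral_eq_one : ∀ θ ∈ Θ, ∫⁻ x, ENNReal.ofReal (p θ x) ∂μ = 1

/-- The law of one observation whose density with respect to `μ` is `f`. -/
def densityLaw {X : Type*} [MeasurableSpace X] (μ : Measure X) (f : X → ℝ) : Measure X :=
  μ.withDensity fun x => ENNReal.ofReal (f x)

/-- The oracle classifier `D_θ = p_{θ₀} / (p_{θ₀} + p_θ)`; here `f₀ = p_{θ₀}` and `f = p_θ`. -/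
def oracleClassifier {X : Type*} (f₀ f : X → ℝ) (x : X) : ℝ := f₀ x / (f₀ x + f x)

/-- The log-posterior residual `u_θ` of the trained classifier `D` on the sample `x`:
`∑ᵢ (log ((1 - D) / (1 - D_θ)) - log (D / D_θ))(xᵢ)`, with `f₀ = p_{θ₀}` and `f = p_θ`. -/
def posteriorResidual {X : Type*} {n : ℕ} (f₀ f D : X → ℝ) (x : Fin n → X) : ℝ :=
  ∑ i, (Real.log ((1 - D (x i)) / (1 - oracleClassifier f₀ f (x i)))
    - Real.log (D (x i) / oracleClassifier f₀ f (x i)))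

/-- The likelihood estimator `p_{θ₀}^{(n)} exp (∑ᵢ log ((1 - D) / D)(xᵢ))`, with `f₀ = p_{θ₀}`.
By `estimatedLikelihood_eq` it is `p_θ^{(n)} exp u_θ`; this form also makes sense
where the residual is infinite. -/
def estimatedLikelihood {X : Type*} {n : ℕ} (f₀ D : X → ℝ) (x : Fin n → X) : ℝ :=
  (∏ i, f₀ (x i)) * Real.exp (∑ i, Real.log ((1 - D (x i)) / D (x i)))

theorem estimatedLikelihood_eq {X : Type*} {n : ℕ} (f₀ f D : X → ℝ) (x : Fin n → X)
    (hD : ∀ i, D (x i) ∈ Set.Ioo (0 : ℝ) 1) (h₀ : ∀ i, 0 < f₀ (x i)) (h : ∀ i, 0 < f (x i)) :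
    estimatedLikelihood f₀ D x = (∏ i, f (x i)) * Real.exp (posteriorResidual f₀ f D x) := by
  unfold estimatedLikelihood posteriorResidual
  rw [Real.exp_sum, Real.exp_sum, ← Finset.prod_mul_distrib, ← Finset.prod_mul_distrib]
  refine Finset.prod_congr rfl fun i _ => ?_
  obtain ⟨hD0, hD1⟩ := hD i
  have h0 := h₀ i
  have h1 := h i
  have hD1' : 0 < 1 - D (x i) := by linarith
  have e : 1 - oracleClassifier f₀ f (x i) = f (x i) / (f₀ (x i) + f (x i)) := by
    unfold oracleClassifier; field_simp; ring
  rw [e, Real.exp_sub, Real.exp_log (by positivity), Real.exp_log (by positivity),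
    Real.exp_log (by unfold oracleClassifier; positivity)]
  unfold oracleClassifier
  field_simp

/-- `C_θ = ∫ p_θ^{(n)} e^{u_θ} dμⁿ`, where `f₀ = p_{θ₀}` and `D x` is the classifier trained on the
sample `x` (and on latent data, which are held fixed here). -/
def normConst {X : Type*} [MeasurableSpace X] {n : ℕ} (μ : Measure X) (f₀ : X → ℝ)
    (D : (Fin n → X) → X → ℝ) : ℝ :=
  ∫ x, estimatedLikelihood f₀ (D x) x ∂(Measure.pi fun _ : Fin n => μ)

/-- The misspecified likelihood `p_θ^{(n)} e^{u_θ} / C_θ`. -/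
def tiltedLikelihood {X : Type*} [MeasurableSpace X] {n : ℕ} (μ : Measure X) (f₀ : X → ℝ)
    (D : (Fin n → X) → X → ℝ) (x : Fin n → X) : ℝ :=
  estimatedLikelihood f₀ (D x) x / normConst μ f₀ D

/-- `sup_{h ∈ K} |f n h| → 0` in (outer) `P n`-probability. -/
def SupTendstoZeroInProb {Ω : ℕ → Type*} [∀ n, MeasurableSpace (Ω n)] (P : ∀ n, Measure (Ω n))
    {d : ℕ} (K : Set (Euc d)) (f : ∀ n, Euc d → Ω n → ℝ) : Prop :=
  ∀ δ : ℝ, 0 < δ → Tendsto (fun n => P n {ω | ∃ h ∈ K, δ < |f n h ω|}) atTop (𝓝 0)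

/-- The misspecified LAN condition at `θs` with rate `ε`, nonsingular matrix `V` and random
centering `Δ n`, for the likelihoods `lik n θ`: for every compact `K`,
`sup_{h ∈ K} |log (lik (θs + ε h) / lik θs) - h' V Δ - h' V h / 2| → 0` in `P n`-probability. -/
def MisspecifiedLAN {Ω : ℕ → Type*} [∀ n, MeasurableSpace (Ω n)] (P : ∀ n, Measure (Ω n))
    {d : ℕ} (lik : ∀ n, Euc d → Ω n → ℝ) (θs : Euc d) (ε : ℕ → ℝ)
    (V : Matrix (Fin d) (Fin d) ℝ) (Δ : ∀ n, Ω n → Euc d) : Prop :=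
  IsUnit V.det ∧ (∀ n, AEMeasurable (Δ n) (P n)) ∧
    ∀ K : Set (Euc d), IsCompact K →
      SupTendstoZeroInProb P K fun n h ω =>
        Real.log (lik n (θs + ε n • h) ω / lik n θs ω)
          - inner ℝ h (V.toEuclideanLin (Δ n ω)) - 1 / 2 * inner ℝ h (V.toEuclideanLin h)

end

/-! ### Empirical process: truncated exponential moments, tails and Chebyshev bounds. -/

noncomputable section

/-! Almost surely all densities and norming constants involved are positive, so the logarithm of the
tilted ratio splits exactly into the log-likelihood ratio of the model, plus the increment of the
residual, minus the increment of `log C`. The last two are linear in `h` up to `o_P(1)` by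
assumption; the work lies in the model part.

Put `r_h = √n log(p_{θ* + h/√n} / p_{θ*}) - h'ℓ̇` and let `G_n` be the empirical process. Then the
log-likelihood ratio minus `h' √n ℙ_n ℓ̇` equals `G_n r_h + √n P r_h`. The quadratic expansion of
the mean gives `√n P r_h → h'Vh/2` uniformly on bounded sets: subtracting the score cancels the
linear term, whether or not `P ℓ̇` vanishes.

It remains to show that `G_n r_h → 0` uniformly over bounded sets of `h`. For fixed `h` this is
Chebyshev, since `P r_h² → 0` by differentiability and domination. Uniformity comes from chaining
(`supTendstoZeroInProb_empiricalFluctuation`): `h ↦ r_h` is Lipschitz with constant `M = 2m`. As `M`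
has only two moments, one works on the event that no `M (x i)` exceeds `√n`, whose probability tends
to 1. There normalized increments have tails of order `exp (-t)`, enough against the geometric
growth of nets in `ℝ^d`.

Suprema over uncountable sets raise no measurability question: probabilities of exceedance are outer
measures, and monotonicity and subadditivity suffice. -/

/-- The empirical process `√n (ℙₙ - P) f` on the sample `x`. -/
def empiricalFluctuation {X : Type*} [MeasurableSpace X] (P : Measure X) {n : ℕ} (f : X → ℝ)
    (x : Fin n → X) : ℝ :=
  (√(n : ℝ))⁻¹ * ∑ i, (f (x i) - ∫ y, f y ∂P)

/-- The exponent that controls the exponential moments of the truncated empirical process of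
functions with envelope `M`. -/
def truncExponent {X : Type*} [MeasurableSpace X] (P : Measure X) (M : X → ℝ) : ℝ :=
  (∫ x, M x ^ 2 ∂P)
    + 2 * ((∫ x, M x ^ 2 ∂P) + (∫ x, M x ∂P) ^ 2) * Real.exp (1 + ∫ x, M x ∂P)

/-- Second-order Taylor remainder. Keeping the linear term exact lets centring cancel it under the
integral, so a summand of size `1/√n` costs only `O(1/n)`. -/
theorem exp_le_one_add_add_sq_mul {x c : ℝ} (h : |x| ≤ c) :
    Real.exp x ≤ 1 + x + x ^ 2 * Real.exp c := by
  have h1 := Complex.norm_exp_sub_sum_le_norm_mul_exp (x : ℂ) 2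
  simp only [Finset.sum_range_succ, Finset.sum_range_zero, Nat.factorial, pow_zero, pow_one] at h1
  have h2 : (Complex.exp x - (0 + 1 / ((1 : ℕ) : ℂ) + x / (((0 + 1) * 1 : ℕ) : ℂ)))
      = ((Real.exp x - (1 + x) : ℝ) : ℂ) := by
    push_cast; ring
  rw [h2, Complex.norm_real, Complex.norm_real, Real.norm_eq_abs, Real.norm_eq_abs, sq_abs] at h1
  have h3 : x ^ 2 * Real.exp |x| ≤ x ^ 2 * Real.exp c := by gcongr
  have := le_abs_self (Real.exp x - (1 + x))
  linarith

section

variable {X : Type*} [MeasurableSpace X] {P : Measure X}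

theorem empiricalFluctuation_neg {n : ℕ} (f : X → ℝ) (x : Fin n → X) :
    empiricalFluctuation P (fun y => -f y) x = -empiricalFluctuation P f x := by
  simp only [empiricalFluctuation, integral_neg, Finset.sum_sub_distrib, Finset.sum_neg_distrib]
  simp; ring

theorem empiricalFluctuation_sub {n : ℕ} {f g : X → ℝ} (hf : Integrable f P) (hg : Integrable g P)
    (x : Fin n → X) :
    empiricalFluctuation P (fun y => f y - g y) x
      = empiricalFluctuation P f x - empiricalFluctuation P g x := by
  simp only [empiricalFluctuation, integral_sub hf hg, Finset.sum_sub_distrib]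
  simp; ring

theorem empiricalFluctuation_const_mul {n : ℕ} (c : ℝ) (f : X → ℝ) (x : Fin n → X) :
    empiricalFluctuation P (fun y => c * f y) x = c * empiricalFluctuation P f x := by
  simp only [empiricalFluctuation, integral_const_mul, ← mul_sub, ← Finset.mul_sum]
  ring

variable [IsProbabilityMeasure P]

theorem ae_pi_forall {n : ℕ} {p : X → Prop} (h : ∀ᵐ x ∂P, p x) :
    ∀ᵐ x ∂(Measure.pi fun _ : Fin n => P), ∀ i, p (x i) :=
  ae_all_iff.2 fun i => (Measure.quasiMeasurePreserving_eval (fun _ : Fin n => P) i).ae h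

variable {M : X → ℝ}

/-- One truncated and centred summand has exponential moment `1 + O(1/n)`. -/
theorem integral_exp_trunc_le {n : ℕ} (hn : 0 < n) (hMm : Measurable M) (hM0 : ∀ x, 0 ≤ M x)
    (hM : MemLp M 2 P) {f : X → ℝ} (hf : AEStronglyMeasurable f P)
    (hfM : ∀ᵐ x ∂P, |f x| ≤ M x) :
    Integrable (fun x => Real.exp ((√(n : ℝ))⁻¹ *
      ({x | M x ≤ √(n : ℝ)}.indicator f x - ∫ y, f y ∂P))) P ∧
    ∫ x, Real.exp ((√(n : ℝ))⁻¹ *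
      ({x | M x ≤ √(n : ℝ)}.indicator f x - ∫ y, f y ∂P)) ∂P
        ≤ 1 + truncExponent P M / n := by
  have hn' : (0 : ℝ) < n := by exact_mod_cast hn
  have hs : 0 < √(n : ℝ) := Real.sqrt_pos.2 hn'
  have hs1 : 1 ≤ √(n : ℝ) := Real.one_le_sqrt.2 (by exact_mod_cast hn)
  have hss : √(n : ℝ) * √(n : ℝ) = n := Real.mul_self_sqrt hn'.le
  have hMi : Integrable M P := hM.integrable one_le_two
  have hM2 : Integrable (fun x => M x ^ 2) P := hM.integrable_sq
  have hfi : Integrable f P := hMi.mono' hf hfM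
  set e := ∫ y, f y ∂P with he
  set a := ∫ y, M y ∂P with ha
  have ha0 : 0 ≤ a := integral_nonneg hM0
  have hea : |e| ≤ a := by
    refine (abs_integral_le_integral_abs).trans ?_
    exact integral_mono_ae hfi.abs hMi hfM
  set s := √(n : ℝ) with hsdef
  have hset : MeasurableSet {x | M x ≤ s} := measurableSet_le hMm measurable_const
  -- The truncated `f` is centred at the mean of the untruncated one, so that `F` is exactly a
  -- summand of the empirical process wherever truncation is inactive.
  set F : X → ℝ := fun x => s⁻¹ * ({x | M x ≤ s}.indicator f x - e) with hF
  have hFm : AEStronglyMeasurable F P :=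
    ((hf.indicator hset).sub aestronglyMeasurable_const).const_mul _
  have hFbd : ∀ᵐ x ∂P, |F x| ≤ 1 + a ∧
      Real.exp (F x) ≤ 1 + s⁻¹ * (f x - e) + (n : ℝ)⁻¹ * M x ^ 2
        + (2 * Real.exp (1 + a) * (n : ℝ)⁻¹) * (M x ^ 2 + a ^ 2) := by
    filter_upwards [hfM] with x hx
    have hτ : |{x | M x ≤ s}.indicator f x| ≤ s ∧ |{x | M x ≤ s}.indicator f x| ≤ M x ∧
        {x | M x ≤ s}.indicator f x - f x ≤ s⁻¹ * M x ^ 2 := by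
      by_cases h : M x ≤ s
      · rw [Set.indicator_of_mem (by exact h)]
        refine ⟨hx.trans h, hx, ?_⟩
        rw [sub_self]; positivity
      -- Where `M > s`, truncation changes `f` by at most `M ≤ M² / s`; this bias is the first term
      -- of `truncExponent`.
      · rw [Set.indicator_of_notMem (by exact h)]
        refine ⟨by simpa using hs.le, by simpa using hM0 x, ?_⟩
        have h1 : s ≤ M x := (not_le.1 h).le
        have h2 : M x ≤ s⁻¹ * M x ^ 2 := by
          rw [inv_mul_eq_div, le_div_iff₀ hs, sq]
          exact mul_le_mul_of_nonneg_left h1 (hM0 x)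
        have := neg_abs_le (f x)
        linarith
    obtain ⟨h1, h2, h3⟩ := hτ
    set τ := {x | M x ≤ s}.indicator f x
    have hb : |F x| ≤ 1 + a := by
      have : |F x| = s⁻¹ * |τ - e| := by
        simp only [hF]; rw [abs_mul, abs_of_pos (inv_pos.2 hs)]
      rw [this, inv_mul_le_iff₀ hs]
      have : |τ - e| ≤ |τ| + |e| := abs_sub _ _
      -- `s + a ≤ s (1 + a)` because `s ≥ 1`.
      nlinarith
    refine ⟨hb, (exp_le_one_add_add_sq_mul hb).trans ?_⟩
    have hF1 : F x ≤ s⁻¹ * (f x - e) + (n : ℝ)⁻¹ * M x ^ 2 := by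
      have : s⁻¹ * (τ - f x) ≤ s⁻¹ * (s⁻¹ * M x ^ 2) := by gcongr
      rw [← mul_assoc, ← mul_inv, hss] at this
      simp only [hF]
      linarith
    have hF2 : F x ^ 2 ≤ 2 * (n : ℝ)⁻¹ * (M x ^ 2 + a ^ 2) := by
      have h4 : (τ - e) ^ 2 ≤ 2 * (M x ^ 2 + a ^ 2) := by
        have h5 : τ ^ 2 ≤ M x ^ 2 := sq_le_sq.2 (h2.trans (le_abs_self _))
        have h6 : e ^ 2 ≤ a ^ 2 := sq_le_sq.2 (hea.trans (le_abs_self _))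
        nlinarith [sq_nonneg (τ + e)]
      have h5 : F x ^ 2 = (n : ℝ)⁻¹ * (τ - e) ^ 2 := by
        simp only [hF]; rw [mul_pow, inv_pow, sq s, hss]
      rw [h5]
      have : (n : ℝ)⁻¹ * (τ - e) ^ 2 ≤ (n : ℝ)⁻¹ * (2 * (M x ^ 2 + a ^ 2)) := by gcongr
      linarith
    have : F x ^ 2 * Real.exp (1 + a) ≤ 2 * (n : ℝ)⁻¹ * (M x ^ 2 + a ^ 2) * Real.exp (1 + a) := by
      gcongr
    linarith
  have hint : Integrable (fun x => Real.exp (F x)) P := by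
    refine Integrable.of_bound (Real.continuous_exp.comp_aestronglyMeasurable hFm)
      (Real.exp (1 + a)) ?_
    filter_upwards [hFbd] with x hx
    rw [Real.norm_eq_abs, Real.abs_exp]
    exact Real.exp_le_exp.2 ((le_abs_self _).trans hx.1)
  refine ⟨hint, ?_⟩
  have i1 : Integrable (fun x => 1 + s⁻¹ * (f x - e)) P :=
    (integrable_const _).add ((hfi.sub (integrable_const _)).const_mul _)
  have i2 : Integrable (fun x => 1 + s⁻¹ * (f x - e) + (n : ℝ)⁻¹ * M x ^ 2) P :=
    i1.add (hM2.const_mul _)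
  have i3 : Integrable (fun x => (2 * Real.exp (1 + a) * (n : ℝ)⁻¹) * (M x ^ 2 + a ^ 2)) P :=
    (hM2.add (integrable_const _)).const_mul _
  refine (integral_mono_ae hint (i2.add i3) (hFbd.mono fun x hx => hx.2)).trans (le_of_eq ?_)
  simp only [Pi.add_apply]
  have i4 : ∫ x, 1 + s⁻¹ * (f x - e) ∂P = 1 := by
    have i0 : Integrable (fun x => s⁻¹ * (f x - e)) P :=
      (hfi.sub (integrable_const _)).const_mul _
    rw [integral_add (integrable_const _) i0, integral_const_mul, integral_sub hfi (integrable_const _)]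
    simp [← he]
  rw [integral_add i2 i3, integral_add i1 (hM2.const_mul _), i4, integral_const_mul,
    integral_const_mul, integral_add hM2 (integrable_const _)]
  simp only [integral_const, probReal_univ, smul_eq_mul, one_mul, truncExponent, ← ha]
  field_simp
  ring

/-- Exponential tail of the empirical process on the event that the envelope does not
exceed `√n`. -/
theorem measure_le_empiricalFluctuation {n : ℕ} (hn : 0 < n) (hMm : Measurable M)
    (hM0 : ∀ x, 0 ≤ M x) (hM : MemLp M 2 P) {f : X → ℝ} (hf : AEStronglyMeasurable f P)
    (hfM : ∀ᵐ x ∂P, |f x| ≤ M x) (t : ℝ) :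
    (Measure.pi fun _ : Fin n => P)
        {x | (∀ i, M (x i) ≤ √(n : ℝ)) ∧ t ≤ empiricalFluctuation P f x}
      ≤ ENNReal.ofReal (Real.exp (truncExponent P M - t)) := by
  have hn' : (0 : ℝ) < n := by exact_mod_cast hn
  obtain ⟨hint, hle⟩ := integral_exp_trunc_le hn hMm hM0 hM hf hfM
  set G : X → ℝ := fun x => Real.exp ((√(n : ℝ))⁻¹ *
      ({x | M x ≤ √(n : ℝ)}.indicator f x - ∫ y, f y ∂P)) with hG
  have hGi : Integrable (fun x : Fin n → X => ∏ i, G (x i)) (Measure.pi fun _ : Fin n => P) :=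
    Integrable.fintype_prod (f := fun _ => G) fun _ => hint
  have hG0 : 0 ≤ᵐ[Measure.pi fun _ : Fin n => P] fun x : Fin n → X => ∏ i, G (x i) :=
    ae_of_all _ fun x => Finset.prod_nonneg fun i _ => (Real.exp_pos _).le
  have hmark := mul_meas_ge_le_integral_of_nonneg hG0 hGi (Real.exp t)
  rw [integral_fintype_prod_eq_pow, Fintype.card_fin] at hmark
  -- `(1 + B/n)^n ≤ exp B`: independence turns the `O(1/n)` bound into one uniform in `n`.
  have hpow : (∫ x, G x ∂P) ^ n ≤ Real.exp (truncExponent P M) := by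
    have h0 : 0 ≤ ∫ x, G x ∂P := integral_nonneg fun x => (Real.exp_pos _).le
    have h1 : ∫ x, G x ∂P ≤ Real.exp (truncExponent P M / n) := by
      refine hle.trans ?_
      have := Real.add_one_le_exp (truncExponent P M / n)
      linarith
    refine (pow_le_pow_left₀ h0 h1 n).trans (le_of_eq ?_)
    rw [← Real.exp_nat_mul]
    congr 1
    field_simp
  refine (measure_mono (t := {x | Real.exp t ≤ ∏ i, G (x i)}) ?_).trans ?_
  · rintro x ⟨hx, ht⟩
    have : ∏ i, G (x i) = Real.exp (empiricalFluctuation P f x) := by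
      simp only [hG, empiricalFluctuation]
      rw [← Real.exp_sum, Finset.mul_sum]
      congr 1
      refine Finset.sum_congr rfl fun i _ => ?_
      rw [Set.indicator_of_mem (by exact hx i)]
    rw [Set.mem_ofPred_eq, this]
    exact Real.exp_le_exp.2 ht
  · rw [← ENNReal.ofReal_toReal (measure_ne_top (Measure.pi fun _ : Fin n => P) _)]
    refine ENNReal.ofReal_le_ofReal ?_
    rw [Real.exp_sub, le_div_iff₀ (Real.exp_pos t), mul_comm]
    exact hmark.trans hpow

theorem measure_le_abs_empiricalFluctuation {n : ℕ} (hn : 0 < n) (hMm : Measurable M)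
    (hM0 : ∀ x, 0 ≤ M x) (hM : MemLp M 2 P) {f : X → ℝ} (hf : AEStronglyMeasurable f P)
    (hfM : ∀ᵐ x ∂P, |f x| ≤ M x) (t : ℝ) :
    (Measure.pi fun _ : Fin n => P)
        {x | (∀ i, M (x i) ≤ √(n : ℝ)) ∧ t ≤ |empiricalFluctuation P f x|}
      ≤ 2 * ENNReal.ofReal (Real.exp (truncExponent P M - t)) := by
  have h1 := measure_le_empiricalFluctuation hn hMm hM0 hM hf hfM t
  have h2 := measure_le_empiricalFluctuation hn hMm hM0 hM hf.neg
    (hfM.mono fun x hx => by simpa using hx) t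
  rw [two_mul]
  refine (measure_mono ?_).trans ((measure_union_le _ _).trans (add_le_add h1 h2))
  rintro x ⟨hx, ht⟩
  rcases le_abs.1 ht with h | h
  · exact Or.inl ⟨hx, h⟩
  · refine Or.inr ⟨hx, ?_⟩
    have := empiricalFluctuation_neg (P := P) f x
    change t ≤ empiricalFluctuation P (fun y => -f y) x
    rwa [this]

/-- Chebyshev's inequality for the empirical process. -/
theorem measure_lt_abs_empiricalFluctuation_le {n : ℕ} {f : X → ℝ} (hf : MemLp f 2 P) {t : ℝ}
    (ht : 0 < t) :
    (Measure.pi fun _ : Fin n => P) {x | t < |empiricalFluctuation P f x|}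
      ≤ ENNReal.ofReal ((∫ x, f x ^ 2 ∂P) / t ^ 2) := by
  rcases Nat.eq_zero_or_pos n with rfl | hn
  · simp [empiricalFluctuation, not_lt.2 ht.le]
  have hn' : (0 : ℝ) < n := by exact_mod_cast hn
  have hs : 0 < √(n : ℝ) := Real.sqrt_pos.2 hn'
  have hfi : Integrable f P := hf.integrable one_le_two
  have hfe : ∀ i : Fin n, MemLp (fun x : Fin n → X => f (x i)) 2 (Measure.pi fun _ => P) :=
    fun i => hf.comp_measurePreserving (measurePreserving_eval _ i)
  set S : (Fin n → X) → ℝ := ∑ i, fun x => f (x i) with hS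
  have hSm : MemLp S 2 (Measure.pi fun _ : Fin n => P) := memLp_finsetSum' _ fun i _ => hfe i
  have hSi : ∫ x, S x ∂(Measure.pi fun _ : Fin n => P) = n * ∫ y, f y ∂P := by
    simp only [hS, Finset.sum_apply]
    rw [integral_finsetSum _ fun i _ => (hfe i).integrable one_le_two]
    have : ∀ i : Fin n, ∫ x : Fin n → X, f (x i) ∂(Measure.pi fun _ => P) = ∫ y, f y ∂P :=
      fun i => by
        have hmp := measurePreserving_eval (fun _ : Fin n => P) i
        have := integral_map hmp.aemeasurable (f := f)
          (by rw [hmp.map_eq]; exact hf.1)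
        rw [hmp.map_eq] at this
        exact this.symm
    simp [this]
  have hvar : ProbabilityTheory.variance S (Measure.pi fun _ : Fin n => P)
      ≤ n * ∫ x, f x ^ 2 ∂P := by
    rw [hS, ProbabilityTheory.variance_sum_pi (X := fun _ => f) fun _ => hf]
    simp only [Finset.sum_const, Finset.card_univ, Fintype.card_fin, nsmul_eq_mul]
    gcongr
    exact ProbabilityTheory.variance_le_expectation_sq hf.1
  have hch := ProbabilityTheory.meas_ge_le_variance_div_sq hSm (mul_pos hs ht)
  refine (measure_mono ?_).trans (hch.trans (ENNReal.ofReal_le_ofReal ?_))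
  · intro x hx
    rw [Set.mem_ofPred_eq] at hx ⊢
    rw [hSi]
    have : empiricalFluctuation P f x = (√(n : ℝ))⁻¹ * (S x - n * ∫ y, f y ∂P) := by
      simp [empiricalFluctuation, hS, Finset.sum_sub_distrib]
    rw [this, abs_mul, abs_of_pos (inv_pos.2 hs), lt_inv_mul_iff₀ hs] at hx
    exact hx.le
  · rw [mul_pow, Real.sq_sqrt hn'.le, div_le_div_iff₀ (by positivity) (by positivity)]
    nlinarith [mul_le_mul_of_nonneg_right hvar (sq_nonneg t)]

/-- With a square-integrable envelope, the largest of `n` values exceeds `√n` with vanishing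
probability. -/
theorem tendsto_measure_exists_sqrt_lt (hMm : Measurable M) (hM : MemLp M 2 P)
    (hM0 : ∀ x, 0 ≤ M x) :
    Tendsto (fun n : ℕ => (Measure.pi fun _ : Fin n => P) {x | ¬ ∀ i, M (x i) ≤ √(n : ℝ)})
      atTop (𝓝 0) := by
  have hM2 : Integrable (fun x => M x ^ 2) P := hM.integrable_sq
  have hfin : ∫⁻ x, ENNReal.ofReal (M x ^ 2) ∂P ≠ ⊤ := by
    have := hM2.2
    rw [hasFiniteIntegral_iff_ofReal (ae_of_all _ fun x => sq_nonneg (M x))] at this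
    exact this.ne
  have hsets : ∀ n : ℕ, MeasurableSet {x | √(n : ℝ) < M x} := fun n =>
    measurableSet_lt measurable_const hMm
  have hlim : Tendsto (fun n : ℕ => ∫⁻ x in {x | √(n : ℝ) < M x}, ENNReal.ofReal (M x ^ 2) ∂P)
      atTop (𝓝 0) := by
    have h0 : Tendsto (fun n : ℕ => P {x | √(n : ℝ) < M x}) atTop (𝓝 0) := by
      have := tendsto_measure_iInter_atTop (μ := P) (s := fun n : ℕ => {x | √(n : ℝ) < M x})
        (fun n => (hsets n).nullMeasurableSet)
        (fun a b hab x hx => by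
          have : √(a : ℝ) ≤ √(b : ℝ) := Real.sqrt_le_sqrt (by exact_mod_cast hab)
          exact this.trans_lt hx) ⟨0, measure_ne_top _ _⟩
      have he : (⋂ n : ℕ, {x | √(n : ℝ) < M x}) = ∅ := by
        ext x
        simp only [Set.mem_iInter, Set.mem_ofPred_eq, Set.mem_empty_iff_false, iff_false, not_forall,
          not_lt]
        obtain ⟨n, hn⟩ := exists_nat_ge (M x ^ 2)
        exact ⟨n, Real.le_sqrt_of_sq_le hn⟩
      rwa [he, measure_empty] at this
    exact tendsto_setLIntegral_zero hfin h0
  refine tendsto_of_tendsto_of_tendsto_of_le_of_le' tendsto_const_nhds hlim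
    (Eventually.of_forall fun _ => bot_le) ?_
  filter_upwards [eventually_gt_atTop 0] with n hn
  have hn' : (0 : ℝ) < n := by exact_mod_cast hn
  have hsub : {x : Fin n → X | ¬ ∀ i, M (x i) ≤ √(n : ℝ)}
      ⊆ ⋃ i, Function.eval i ⁻¹' {x | √(n : ℝ) < M x} := by
    intro x hx
    simpa using hx
  refine (measure_mono hsub).trans ((measure_iUnion_le _).trans ?_)
  rw [tsum_fintype]
  have h1 : ∀ i : Fin n, (Measure.pi fun _ : Fin n => P) (Function.eval i ⁻¹' {x | √(n : ℝ) < M x})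
      = P {x | √(n : ℝ) < M x} := fun i =>
    (measurePreserving_eval (fun _ : Fin n => P) i).measure_preimage (hsets n).nullMeasurableSet
  simp only [h1, Finset.sum_const, Finset.card_univ, Fintype.card_fin, nsmul_eq_mul]
  -- The union bound `n P(M > √n)` is at most the integral of `M²` over `{M > √n}`, since `n < M²`
  -- there.
  rw [← setLIntegral_one, ← lintegral_const_mul _ measurable_const]
  refine setLIntegral_mono (by fun_prop) fun x hx => ?_
  rw [mul_one, ← ENNReal.ofReal_natCast]
  refine ENNReal.ofReal_le_ofReal ?_
  have h2 : √(n : ℝ) < M x := hx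
  exact (Real.sqrt_le_left (hM0 x)).1 h2.le

end

/-! ### Dyadic nets and the chaining inequality. -/

/-- A bounded subset of `ℝ^d` has nets of mesh `O(2⁻ᵏ)` whose sizes grow geometrically. -/
theorem exists_dyadic_nets {d : ℕ} {T : Set (Euc d)} (hT : Bornology.IsBounded T) :
    ∃ (A D : ℕ) (c : ℝ) (π : ℕ → Euc d → Euc d) (G : ℕ → Finset (Euc d)), 0 < D ∧ 0 ≤ c ∧
      ∀ k, (∀ h ∈ T, π k h ∈ T) ∧ (∀ h ∈ T, ‖π k h - h‖ ≤ c * (1 / 2) ^ k) ∧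
        (∀ h ∈ T, π k h ∈ G k) ∧ (G k).card ≤ A * D ^ k := by
  classical
  obtain ⟨R, hR⟩ := hT.exists_norm_le
  obtain ⟨N, hN⟩ := exists_nat_ge R
  -- Cubes of side `2⁻ᵏ`, of diameter `√d 2⁻ᵏ`. The net map sends `h` to a chosen point of `T` in
  -- its own cube, so chains stay inside `T`. Each coordinate takes at most `2ᵏ⁺¹(N + 1) + 1 ≤ 2ᵏ(2N
  -- + 3)` integer values.
  let cell : ℕ → Euc d → Fin d → ℤ := fun k h i => ⌊(2 : ℝ) ^ k * h i⌋
  let B : ℕ → Finset (Fin d → ℤ) := fun k =>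
    Fintype.piFinset fun _ => Finset.Icc (-(2 ^ k * (N + 1) : ℤ)) (2 ^ k * (N + 1))
  refine ⟨(2 * N + 3) ^ d, 2 ^ d, √d, fun k h => Function.invFunOn (cell k) T (cell k h),
    fun k => (B k).image (Function.invFunOn (cell k) T), by positivity, by positivity,
    fun k => ⟨fun h hh => Function.invFunOn_mem ⟨h, hh, rfl⟩, fun h hh => ?_, fun h hh => ?_, ?_⟩⟩
  · have heq : cell k (Function.invFunOn (cell k) T (cell k h)) = cell k h :=
      Function.invFunOn_eq ⟨h, hh, rfl⟩
    beta_reduce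
    generalize Function.invFunOn (cell k) T (cell k h) = y at heq ⊢
    rw [EuclideanSpace.norm_eq]
    refine Real.sqrt_le_iff.2 ⟨by positivity, ?_⟩
    rw [mul_pow, Real.sq_sqrt (by positivity)]
    have : ∀ i ∈ (Finset.univ : Finset (Fin d)), ‖(y - h) i‖ ^ 2 ≤ ((1 / 2 : ℝ) ^ k) ^ 2 := by
      intro i _
      have h1 : ⌊(2 : ℝ) ^ k * y i⌋ = ⌊(2 : ℝ) ^ k * h i⌋ := congrFun heq i
      have h2 : |(2 : ℝ) ^ k * y i - 2 ^ k * h i| < 1 := Int.abs_sub_lt_one_of_floor_eq_floor h1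
      rw [← mul_sub, abs_mul, abs_of_pos (by positivity)] at h2
      gcongr
      rw [PiLp.sub_apply, Real.norm_eq_abs, one_div, inv_pow, ← one_div, le_div_iff₀ (by positivity),
        mul_comm]
      exact h2.le
    simpa using Finset.sum_le_sum this
  · refine Finset.mem_image_of_mem _ (Fintype.mem_piFinset.2 fun i => ?_)
    have h1 : |h i| ≤ N := ((PiLp.norm_apply_le h i).trans (hR h hh)).trans hN
    have h2 : (1 : ℝ) ≤ 2 ^ k := one_le_pow₀ (by norm_num)
    obtain ⟨h3, h4⟩ := abs_le.1 h1
    have h5 := Int.floor_le ((2 : ℝ) ^ k * h i)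
    have h6 := Int.lt_floor_add_one ((2 : ℝ) ^ k * h i)
    rw [Finset.mem_Icc]
    constructor
    · have : ((-(2 ^ k * (N + 1)) : ℤ) : ℝ) ≤ (⌊(2 : ℝ) ^ k * h i⌋ : ℝ) := by
        push_cast; nlinarith
      exact Int.cast_le.1 this
    · have : (⌊(2 : ℝ) ^ k * h i⌋ : ℝ) ≤ ((2 ^ k * (N + 1) : ℤ) : ℝ) := by
        push_cast; nlinarith
      exact Int.cast_le.1 this
  · refine Finset.card_image_le.trans ?_
    rw [Fintype.card_piFinset]
    simp only [Int.card_Icc, Finset.prod_const, Finset.card_univ, Fintype.card_fin]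
    rw [← pow_mul, mul_comm d k, pow_mul, ← mul_pow]
    gcongr
    have : (1 : ℤ) ≤ 2 ^ k := one_le_pow₀ (by norm_num)
    rw [Int.toNat_le]
    push_cast
    nlinarith

/-- Telescope from level `k₀` along the approximations of `h`, then pass to the limit. -/
theorem abs_le_of_chain {E : Type*} {Z : E → ℝ} {π : ℕ → E → E} {h : E} {k₀ : ℕ} {a : ℕ → ℝ}
    {b s : ℝ} (h0 : |Z (π k₀ h)| ≤ b)
    (hstep : ∀ k, |Z (π (k + k₀ + 1) h) - Z (π (k + k₀) h)| ≤ a k)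
    (hs : ∀ N, ∑ k ∈ Finset.range N, a k ≤ s)
    (hlim : Tendsto (fun k => Z (π k h)) atTop (𝓝 (Z h))) : |Z h| ≤ b + s := by
  have hN : ∀ N, |Z (π (N + k₀) h)| ≤ b + ∑ k ∈ Finset.range N, a k := by
    intro N
    induction N with
    | zero => simpa using h0
    | succ N ih =>
      rw [Finset.sum_range_succ, show N + 1 + k₀ = N + k₀ + 1 by ring]
      have := abs_sub_abs_le_abs_sub (Z (π (N + k₀ + 1) h)) (Z (π (N + k₀) h))
      linarith [hstep N]
  have := (hlim.comp (tendsto_add_atTop_nat k₀)).abs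
  exact le_of_tendsto this (Eventually.of_forall fun N => (hN N).trans (by linarith [hs N]))

/-! ### Chaining for the empirical process over a Lipschitz class. -/

section

variable {X : Type*} [MeasurableSpace X] {P : Measure X} [IsProbabilityMeasure P]
  {M : X → ℝ} {d : ℕ}

/-- Exponential tail of an increment of the empirical process indexed by a Lipschitz class. -/
theorem measure_lt_abs_increment_le {n : ℕ} (hn : 0 < n) (hMm : Measurable M)
    (hM0 : ∀ x, 0 ≤ M x) (hM : MemLp M 2 P) {T : Set (Euc d)} {g : Euc d → X → ℝ}
    (hg : ∀ h ∈ T, Integrable (g h) P)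
    (hLip : ∀ᵐ x ∂P, ∀ h ∈ T, ∀ h' ∈ T, |g h x - g h' x| ≤ M x * ‖h - h'‖) (y z : Euc d) (t : ℝ) :
    (Measure.pi fun _ : Fin n => P) {x | (∀ i, M (x i) ≤ √(n : ℝ)) ∧ y ∈ T ∧ z ∈ T ∧
        ‖y - z‖ * t < |empiricalFluctuation P (g y) x - empiricalFluctuation P (g z) x|}
      ≤ 2 * ENNReal.ofReal (Real.exp (truncExponent P M - t)) := by
  -- The increment divided by `‖y - z‖` has envelope `M`. In the remaining cases the event is empty;
  -- for `y = z` this uses the strict inequality.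
  by_cases hyz : y ∈ T ∧ z ∈ T ∧ y ≠ z
  · obtain ⟨hy, hz, hne⟩ := hyz
    have hpos : 0 < ‖y - z‖ := norm_pos_iff.2 (sub_ne_zero.2 hne)
    refine (measure_mono ?_).trans (measure_le_abs_empiricalFluctuation hn hMm hM0 hM
      (f := fun x => ‖y - z‖⁻¹ * (g y x - g z x)) ?_ ?_ t)
    · rintro x ⟨hx, -, -, hlt⟩
      refine ⟨hx, ?_⟩
      rw [empiricalFluctuation_const_mul, empiricalFluctuation_sub (hg y hy) (hg z hz), abs_mul,
        abs_of_pos (inv_pos.2 hpos), le_inv_mul_iff₀ hpos]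
      exact hlt.le
    · exact ((hg y hy).1.sub (hg z hz).1).const_mul _
    · filter_upwards [hLip] with x hx
      rw [abs_mul, abs_of_pos (inv_pos.2 hpos), inv_mul_le_iff₀ hpos, mul_comm]
      exact hx y hy z hz
  · have : {x : Fin n → X | (∀ i, M (x i) ≤ √(n : ℝ)) ∧ y ∈ T ∧ z ∈ T ∧
        ‖y - z‖ * t < |empiricalFluctuation P (g y) x - empiricalFluctuation P (g z) x|} = ∅ := by
      refine Set.eq_empty_iff_forall_notMem.2 ?_
      rintro x ⟨-, hy, hz, hlt⟩
      refine hyz ⟨hy, hz, ?_⟩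
      rintro rfl
      simp at hlt
    rw [this]
    simp

/-- Probability bound for all the links of one level of a chain. -/
theorem measure_exists_lt_abs_link_le {n : ℕ} (hn : 0 < n) (hMm : Measurable M)
    (hM0 : ∀ x, 0 ≤ M x) (hM : MemLp M 2 P) {T : Set (Euc d)} {g : Euc d → X → ℝ}
    (hg : ∀ h ∈ T, Integrable (g h) P)
    (hLip : ∀ᵐ x ∂P, ∀ h ∈ T, ∀ h' ∈ T, |g h x - g h' x| ≤ M x * ‖h - h'‖)
    {σ τ : Euc d → Euc d} {G H : Finset (Euc d)} {r t : ℝ} (ht : 0 ≤ t)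
    (hσ : ∀ h ∈ T, σ h ∈ T ∧ σ h ∈ G) (hτ : ∀ h ∈ T, τ h ∈ T ∧ τ h ∈ H)
    (hr : ∀ h ∈ T, ‖σ h - τ h‖ ≤ r) :
    (Measure.pi fun _ : Fin n => P) {x | (∀ i, M (x i) ≤ √(n : ℝ)) ∧ ∃ h ∈ T,
        r * t < |empiricalFluctuation P (g (σ h)) x - empiricalFluctuation P (g (τ h)) x|}
      ≤ G.card * (H.card * (2 * ENNReal.ofReal (Real.exp (truncExponent P M - t)))) := by
  refine (measure_mono (t := ⋃ y ∈ G, ⋃ z ∈ H, {x | (∀ i, M (x i) ≤ √(n : ℝ)) ∧ y ∈ T ∧ z ∈ T ∧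
    ‖y - z‖ * t < |empiricalFluctuation P (g y) x - empiricalFluctuation P (g z) x|}) ?_).trans ?_
  · rintro x ⟨hx, h, hh, hlt⟩
    simp only [Set.mem_iUnion]
    exact ⟨σ h, (hσ h hh).2, τ h, (hτ h hh).2, hx, (hσ h hh).1, (hτ h hh).1,
      (mul_le_mul_of_nonneg_right (hr h hh) ht).trans_lt hlt⟩
  · refine (measure_biUnion_finset_le _ _).trans ?_
    rw [← nsmul_eq_mul]
    refine Finset.sum_le_card_nsmul _ _ _ fun y _ => ?_
    refine (measure_biUnion_finset_le _ _).trans ?_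
    rw [← nsmul_eq_mul]
    exact Finset.sum_le_card_nsmul _ _ _ fun z _ =>
      measure_lt_abs_increment_le hn hMm hM0 hM hg hLip y z t

/-- Empirical processes indexed by Lipschitz classes over a bounded subset of `ℝ^d`, with a
square-integrable Lipschitz constant, vanish uniformly in probability as soon as the second
moments of the indexed functions vanish pointwise. -/
theorem supTendstoZeroInProb_empiricalFluctuation (hMm : Measurable M)
    (hM0 : ∀ x, 0 ≤ M x) (hM : MemLp M 2 P) {T : Set (Euc d)} (hT : Bornology.IsBounded T)
    (g : ℕ → Euc d → X → ℝ)
    (hg : ∀ᶠ n in atTop, ∀ h ∈ T, MemLp (g n h) 2 P)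
    (hLip : ∀ᶠ n in atTop, ∀ᵐ x ∂P, ∀ h ∈ T, ∀ h' ∈ T,
      |g n h x - g n h' x| ≤ M x * ‖h - h'‖)
    (hg0 : ∀ h ∈ T, Tendsto (fun n => ∫ x, g n h x ^ 2 ∂P) atTop (𝓝 0)) :
    SupTendstoZeroInProb (fun n => Measure.pi fun _ : Fin n => P) T
      fun n h x => empiricalFluctuation P (g n h) x := by
  classical
  intro δ hδ
  obtain ⟨A, D, c, π, G, hD, hc, hπ⟩ := exists_dyadic_nets hT
  -- Level `k` has at most `A² D^(2k+1)` links, each of length at most `2c 2⁻ᵏ`. The threshold `t =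
  -- b k` gives the tail factor `exp (-b k) = (2D²)⁻ᵏ`, which beats the count and leaves `2⁻ᵏ` in
  -- `q`, while the total displacement `∑ a k` still converges.
  set b : ℝ := Real.log (2 * D ^ 2) with hb
  have hD1 : (1 : ℝ) ≤ D := by exact_mod_cast hD
  have hb0 : 0 ≤ b := Real.log_nonneg (by nlinarith)
  set a : ℕ → ℝ := fun k => 2 * c * (1 / 2) ^ k * (b * k) with ha
  have ha0 : ∀ k, 0 ≤ a k := fun k => by positivity
  have hasum : Summable a := by
    have := summable_pow_mul_geometric_of_norm_lt_one (R := ℝ) 1 (r := 1 / 2) (by norm_num)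
    refine (this.mul_left (2 * c * b)).congr fun k => ?_
    simp only [ha]; ring
  set B := truncExponent P M
  set q : ℕ → ENNReal := fun k =>
    ENNReal.ofReal (2 * (A : ℝ) ^ 2 * D * Real.exp B * (1 / 2) ^ k) with hq
  have hqsum : ∑' k, q k ≠ ⊤ := by
    have : Summable fun k : ℕ => 2 * (A : ℝ) ^ 2 * D * Real.exp B * (1 / 2) ^ k :=
      (summable_geometric_of_lt_one (by norm_num) (by norm_num)).mul_left _
    exact this.tsum_ofReal_ne_top
  rw [ENNReal.tendsto_nhds_zero]
  intro ε hε
  have hε3 : 0 < ε / 3 := ENNReal.div_pos hε.ne' (by norm_num)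
  -- The starting level depends on `δ` and `ε` but not on `n`, so only finitely many points are left
  -- to Chebyshev.
  obtain ⟨k₀, hk1, hk2⟩ : ∃ k₀, ∑' k, a (k + k₀) < δ / 2 ∧ ∑' k, q (k + k₀) ≤ ε / 3 := by
    have e1 := (tendsto_sum_nat_add a).eventually (gt_mem_nhds (half_pos hδ))
    have e2 := ENNReal.tendsto_nhds_zero.1 (ENNReal.tendsto_sum_nat_add q hqsum) _ hε3
    exact (e1.and e2).exists
  -- The finite set `G k₀` may contain arbitrary representatives of cubes that miss `T`, hence the
  -- filter.
  have hpt : Tendsto (fun n : ℕ => ∑ y ∈ G k₀ with y ∈ T,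
      ENNReal.ofReal ((∫ x, g n y x ^ 2 ∂P) / (δ / 2) ^ 2)) atTop (𝓝 0) := by
    have := tendsto_finsetSum (f := fun y (n : ℕ) =>
        ENNReal.ofReal ((∫ x, g n y x ^ 2 ∂P) / (δ / 2) ^ 2)) {y ∈ G k₀ | y ∈ T} fun y hy =>
      ENNReal.tendsto_ofReal ((hg0 y (Finset.mem_filter.1 hy).2).div_const ((δ / 2) ^ 2))
    simpa using this
  filter_upwards [hg, hLip, eventually_gt_atTop 0,
    ENNReal.tendsto_nhds_zero.1 (tendsto_measure_exists_sqrt_lt hMm hM hM0) _ hε3,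
    ENNReal.tendsto_nhds_zero.1 hpt _ hε3] with n hgn hLn hn hgood hptn
  have hgi : ∀ h ∈ T, Integrable (g n h) P := fun h hh => (hgn h hh).integrable one_le_two
  set W := Measure.pi fun _ : Fin n => P
  set S : Euc d → (Fin n → X) → ℝ := fun h x => empiricalFluctuation P (g n h) x with hS
  set bad : Set (Fin n → X) := {x | ¬ ∀ i, M (x i) ≤ √(n : ℝ)}
  set E : ℕ → Set (Fin n → X) := fun k => {x | (∀ i, M (x i) ≤ √(n : ℝ)) ∧ ∃ h ∈ T,
    2 * c * (1 / 2) ^ k * (b * k) < |S (π (k + 1) h) x - S (π k h) x|} with hE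
  set N : Set (Fin n → X) := {x | ¬ ∀ i, ∀ h ∈ T, ∀ h' ∈ T,
    |g n h (x i) - g n h' (x i)| ≤ M (x i) * ‖h - h'‖}
  set C : Set (Fin n → X) := ⋃ y ∈ {y ∈ G k₀ | y ∈ T}, {x | δ / 2 < |S y x|} with hC
  have hN : W N = 0 := ae_pi_forall hLn
  have hCle : W C ≤ ε / 3 := by
    refine (measure_biUnion_finset_le _ _).trans (le_trans ?_ hptn)
    refine Finset.sum_le_sum fun y hy => ?_
    exact measure_lt_abs_empiricalFluctuation_le (hgn y (Finset.mem_filter.1 hy).2) (half_pos hδ)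
  have hEle : ∀ k, W (E k) ≤ q k := by
    intro k
    obtain ⟨h1, h2, h3, h4⟩ := hπ k
    obtain ⟨h1', h2', h3', h4'⟩ := hπ (k + 1)
    refine (measure_exists_lt_abs_link_le hn hMm hM0 hM hgi hLn (σ := π (k + 1)) (τ := π k)
      (G := G (k + 1)) (H := G k) (by positivity) (fun h hh => ⟨h1' h hh, h3' h hh⟩)
      (fun h hh => ⟨h1 h hh, h3 h hh⟩) fun h hh => ?_).trans ?_
    · have e1 : π (k + 1) h - π k h = (π (k + 1) h - h) - (π k h - h) := by abel
      rw [e1]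
      refine (norm_sub_le _ _).trans ((add_le_add (h2' h hh) (h2 h hh)).trans ?_)
      have : c * (1 / 2 : ℝ) ^ (k + 1) ≤ c * (1 / 2) ^ k := by
        rw [pow_succ]
        have : 0 ≤ c * (1 / 2 : ℝ) ^ k := by positivity
        linarith
      linarith
    · have e1 : Real.exp (B - b * k) = Real.exp B * ((1 / 2) ^ k * ((D : ℝ) ^ k)⁻¹ ^ 2) := by
        rw [sub_eq_add_neg, Real.exp_add, Real.exp_neg, mul_comm b, Real.exp_nat_mul, hb,
          Real.exp_log (by positivity)]
        congr 1
        rw [mul_pow, mul_inv, one_div, inv_pow, inv_pow, ← pow_mul, ← pow_mul, mul_comm 2 k]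
      have e2 : ((G (k + 1)).card : ENNReal) ≤ ENNReal.ofReal (A * D ^ (k + 1)) := by
        rw [← ENNReal.ofReal_natCast]
        exact ENNReal.ofReal_le_ofReal (by exact_mod_cast h4')
      have e3 : ((G k).card : ENNReal) ≤ ENNReal.ofReal (A * D ^ k) := by
        rw [← ENNReal.ofReal_natCast]
        exact ENNReal.ofReal_le_ofReal (by exact_mod_cast h4)
      have e4 : (2 : ENNReal) = ENNReal.ofReal 2 := by simp
      refine (mul_le_mul' e2 (mul_le_mul_left e3 _)).trans (le_of_eq ?_)
      rw [e4, ← ENNReal.ofReal_mul (by norm_num), ← ENNReal.ofReal_mul (by positivity),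
        ← ENNReal.ofReal_mul (by positivity), hq]
      congr 1
      rw [e1]
      field_simp
      ring
  have hsub : {x | ∃ h ∈ T, δ < |S h x|} ⊆ (bad ∪ C) ∪ (N ∪ ⋃ k, E (k + k₀)) := by
    rintro x ⟨h, hh, hlt⟩
    by_contra hx
    simp only [Set.mem_union, not_or] at hx
    obtain ⟨⟨hx1, hx2⟩, hx3, hx4⟩ := hx
    have hx1' : ∀ i, M (x i) ≤ √(n : ℝ) := not_not.1 hx1
    have hx3' : ∀ i, ∀ h ∈ T, ∀ h' ∈ T,
      |g n h (x i) - g n h' (x i)| ≤ M (x i) * ‖h - h'‖ := not_not.1 hx3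
    have key : |S h x| ≤ δ / 2 + ∑' k, a (k + k₀) := by
      refine abs_le_of_chain (Z := fun h => S h x) (π := π) (k₀ := k₀)
        (a := fun k => a (k + k₀)) ?_ ?_ ?_ ?_
      · by_contra hcon
        refine hx2 (Set.mem_biUnion (x := π k₀ h) ?_ (not_le.1 hcon))
        simpa using ⟨(hπ k₀).2.2.1 h hh, (hπ k₀).1 h hh⟩
      · intro k
        by_contra hcon
        exact hx4 (Set.mem_iUnion.2 ⟨k, hx1', h, hh, not_le.1 hcon⟩)
      · intro N
        exact ((summable_nat_add_iff k₀).2 hasum).sum_le_tsum _ fun k _ => ha0 _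
      -- Off the null set `N`, both the sample values and, by integrating the envelope, the mean are
      -- continuous along the chain.
      · have hπlim : Tendsto (fun k => ‖π k h - h‖) atTop (𝓝 0) := by
          refine squeeze_zero (fun _ => norm_nonneg _) (fun k => (hπ k).2.1 h hh) ?_
          simpa using (tendsto_pow_atTop_nhds_zero_of_lt_one (r := (1 / 2 : ℝ)) (by norm_num)
            (by norm_num)).const_mul c
        have hval : ∀ i, Tendsto (fun k => g n (π k h) (x i)) atTop (𝓝 (g n h (x i))) := by
          intro i
          refine tendsto_iff_norm_sub_tendsto_zero.2 (squeeze_zero (fun _ => norm_nonneg _)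
            (fun k => hx3' i _ ((hπ k).1 h hh) h hh) ?_)
          simpa using hπlim.const_mul (M (x i))
        have hint : Tendsto (fun k => ∫ y, g n (π k h) y ∂P) atTop (𝓝 (∫ y, g n h y ∂P)) := by
          refine tendsto_iff_norm_sub_tendsto_zero.2 (squeeze_zero (fun _ => norm_nonneg _)
            (g := fun k => (∫ y, M y ∂P) * ‖π k h - h‖) (fun k => ?_) ?_)
          · rw [← integral_sub (hgi _ ((hπ k).1 h hh)) (hgi h hh), ← integral_mul_const]
            refine norm_integral_le_of_norm_le ((hM.integrable one_le_two).mul_const _) ?_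
            filter_upwards [hLn] with y hy
            exact hy _ ((hπ k).1 h hh) h hh
          · simpa using hπlim.const_mul (∫ y, M y ∂P)
        exact (tendsto_finsetSum _ fun i _ => (hval i).sub hint).const_mul _
    linarith
  calc W {x | ∃ h ∈ T, δ < |S h x|} ≤ W ((bad ∪ C) ∪ (N ∪ ⋃ k, E (k + k₀))) := measure_mono hsub
    _ ≤ (W bad + W C) + (W N + W (⋃ k, E (k + k₀))) :=
        (measure_union_le _ _).trans (add_le_add (measure_union_le _ _) (measure_union_le _ _))
    _ ≤ (ε / 3 + ε / 3) + (0 + ε / 3) := by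
        refine add_le_add (add_le_add hgood hCle) (add_le_add hN.le ?_)
        exact (measure_iUnion_le _).trans ((ENNReal.tsum_le_tsum fun k => hEle _).trans hk2)
    _ = ε := by rw [zero_add, ENNReal.add_thirds]

end

/-! ### Logarithms of the tilted likelihood and positivity of the norming constant. -/

theorem log_estimatedLikelihood {X : Type*} {n : ℕ} {f₀ f D : X → ℝ} {x : Fin n → X}
    (hD : ∀ i, D (x i) ∈ Set.Ioo (0 : ℝ) 1) (h₀ : ∀ i, 0 < f₀ (x i)) (h : ∀ i, 0 < f (x i)) :
    0 < estimatedLikelihood f₀ D x ∧ Real.log (estimatedLikelihood f₀ D x)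
      = ∑ i, Real.log (f (x i)) + posteriorResidual f₀ f D x := by
  have hp : 0 < ∏ i, f (x i) := Finset.prod_pos fun i _ => h i
  rw [estimatedLikelihood_eq f₀ f D x hD h₀ h]
  refine ⟨mul_pos hp (Real.exp_pos _), ?_⟩
  rw [Real.log_mul hp.ne' (Real.exp_ne_zero _), Real.log_exp,
    Real.log_prod fun i _ => (h i).ne']

section

variable {X : Type*} [MeasurableSpace X] {μ : Measure X}

theorem isProbabilityMeasure_densityLaw {f : X → ℝ} (h : ∫⁻ x, ENNReal.ofReal (f x) ∂μ = 1) :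
    IsProbabilityMeasure (densityLaw μ f) :=
  ⟨by rw [densityLaw, withDensity_apply _ MeasurableSet.univ, Measure.restrict_univ, h]⟩

theorem ae_pos_densityLaw {f : X → ℝ} (hf : Measurable f) :
    ∀ᵐ x ∂(densityLaw μ f), 0 < f x := by
  rw [densityLaw, ae_withDensity_iff hf.ennreal_ofReal]
  exact ae_of_all _ fun x hx => ENNReal.ofReal_pos.1 (pos_iff_ne_zero.2 hx)

/-- The integrand is positive on the box `{f > 0}ⁿ`, which has positive measure because `f`
integrates to 1. Integrability matters: otherwise the Bochner integral would be 0 by convention. -/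
theorem normConst_pos [SigmaFinite μ] {n : ℕ} {f : X → ℝ} (hf0 : ∀ x, 0 ≤ f x)
    (h1 : ∫⁻ x, ENNReal.ofReal (f x) ∂μ = 1) {D : (Fin n → X) → X → ℝ}
    (hint : Integrable (fun x => estimatedLikelihood f (D x) x) (Measure.pi fun _ : Fin n => μ)) :
    0 < normConst μ f D := by
  have hnn : 0 ≤ fun x : Fin n → X => estimatedLikelihood f (D x) x :=
    fun x => mul_nonneg (Finset.prod_nonneg fun i _ => hf0 _) (Real.exp_pos _).le
  unfold normConst
  rw [integral_pos_iff_support_of_nonneg hnn hint]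
  have hμ : μ {x | 0 < f x} ≠ 0 := by
    intro h0
    have : ∫⁻ x, ENNReal.ofReal (f x) ∂μ = 0 := by
      refine lintegral_eq_zero_of_ae_eq_zero ?_
      have h2 : ∀ᵐ x ∂μ, ¬ 0 < f x := by
        rw [ae_iff]; simpa using h0
      filter_upwards [h2] with x hx
      exact ENNReal.ofReal_eq_zero.2 (not_lt.1 hx)
    rw [h1] at this
    exact one_ne_zero this
  have hpi : 0 < (Measure.pi fun _ : Fin n => μ) (Set.univ.pi fun _ => {x | 0 < f x}) := by
    rw [Measure.pi_pi]
    exact pos_iff_ne_zero.2 (Finset.prod_ne_zero_iff.2 fun _ _ => hμ)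
  refine hpi.trans_le (measure_mono fun x hx => ?_)
  refine (mul_pos (Finset.prod_pos fun i _ => ?_) (Real.exp_pos _)).ne'
  exact hx i (Set.mem_univ i)

theorem log_tiltedLikelihood_div {n : ℕ} {f₀ f f' : X → ℝ} {D D' : (Fin n → X) → X → ℝ}
    {x : Fin n → X} (hD : ∀ i, D x (x i) ∈ Set.Ioo (0 : ℝ) 1)
    (hD' : ∀ i, D' x (x i) ∈ Set.Ioo (0 : ℝ) 1) (h₀ : ∀ i, 0 < f₀ (x i))
    (h : ∀ i, 0 < f (x i)) (h' : ∀ i, 0 < f' (x i)) (hC : 0 < normConst μ f₀ D)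
    (hC' : 0 < normConst μ f₀ D') :
    Real.log (tiltedLikelihood μ f₀ D x / tiltedLikelihood μ f₀ D' x)
      = ∑ i, Real.log (f (x i) / f' (x i))
        + (posteriorResidual f₀ f (D x) x - posteriorResidual f₀ f' (D' x) x)
        - Real.log (normConst μ f₀ D / normConst μ f₀ D') := by
  obtain ⟨e1, e2⟩ := log_estimatedLikelihood hD h₀ h
  obtain ⟨e1', e2'⟩ := log_estimatedLikelihood hD' h₀ h'
  have e3 : ∑ i, Real.log (f (x i) / f' (x i))
      = ∑ i, Real.log (f (x i)) - ∑ i, Real.log (f' (x i)) := by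
    rw [← Finset.sum_sub_distrib]
    exact Finset.sum_congr rfl fun i _ => Real.log_div (h i).ne' (h' i).ne'
  unfold tiltedLikelihood
  rw [Real.log_div (div_pos e1 hC).ne' (div_pos e1' hC').ne', Real.log_div e1.ne' hC.ne',
    Real.log_div e1'.ne' hC'.ne', Real.log_div hC.ne' hC'.ne', e2, e2', e3]
  ring

end

/-! ### The score: size, directional limits and measurability. -/

section

variable {X : Type*} [MeasurableSpace X] {P : Measure X} {d : ℕ} {U : Set (Euc d)} {θs : Euc d}
  {p : Euc d → X → ℝ} {score : X → Euc d}

theorem norm_gradient_log_le {q : Euc d → ℝ} {s : Euc d} {C : ℝ} (hC : 0 ≤ C) (hU : IsOpen U)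
    (hθs : θs ∈ U) (hpos : ∀ θ ∈ U, 0 < q θ)
    (hs : HasGradientAt (fun θ => Real.log (q θ)) s θs)
    (hLip : ∀ θ₁ ∈ U, ∀ θ₂ ∈ U, |Real.log (q θ₁ / q θ₂)| ≤ C * ‖θ₁ - θ₂‖) : ‖s‖ ≤ C := by
  have := hs.hasFDerivAt.le_of_lip' hC ?_
  · simpa using this
  · filter_upwards [hU.mem_nhds hθs] with θ hθ
    rw [← Real.log_div (hpos θ hθ).ne' (hpos θs hθs).ne']
    exact hLip θ hθ θs hθs

theorem tendsto_mul_log_ratio {q : Euc d → ℝ} {s : Euc d} (hU : IsOpen U)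
    (hθs : θs ∈ U) (hpos : ∀ θ ∈ U, 0 < q θ)
    (hs : HasGradientAt (fun θ => Real.log (q θ)) s θs) {c : ℕ → ℝ}
    (hc : Tendsto c atTop atTop) (h : Euc d) :
    Tendsto (fun n => c n * Real.log (q (θs + (1 / c n) • h) / q θs)) atTop (𝓝 (inner ℝ s h)) := by
  have h1 := hs.hasFDerivAt.lim h (c := c) (l := atTop) (tendsto_norm_atTop_atTop.comp hc)
  have h2 : ((InnerProductSpace.toDual ℝ (Euc d)) s) h = inner ℝ s h := rfl
  rw [h2] at h1
  refine h1.congr' ?_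
  have h3 : Tendsto (fun n => θs + (1 / c n) • h) atTop (𝓝 θs) := by
    have : Tendsto (fun n => (1 / c n)) atTop (𝓝 0) := by
      simpa [Function.comp_def] using tendsto_inv_atTop_zero.comp hc
    simpa using (this.smul_const h).const_add θs
  filter_upwards [h3.eventually (hU.mem_nhds hθs)] with n hn
  rw [Real.log_div (hpos _ hn).ne' (hpos _ hθs).ne', smul_eq_mul, one_div]

theorem eventually_forall_add_smul_mem {T : Set (Euc d)}
    (hT : Bornology.IsBounded T) {V : Set (Euc d)} (hV : V ∈ 𝓝 θs) :
    ∀ᶠ n : ℕ in atTop, ∀ h ∈ T, θs + (1 / √(n : ℝ)) • h ∈ V := by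
  obtain ⟨R, hR0, hR⟩ := hT.exists_pos_norm_le
  obtain ⟨r, hr, hrV⟩ := Metric.mem_nhds_iff.1 hV
  have h1 : Tendsto (fun n : ℕ => 1 / √(n : ℝ) * R) atTop (𝓝 0) := by
    have : Tendsto (fun n : ℕ => (√(n : ℝ))⁻¹) atTop (𝓝 0) :=
      tendsto_inv_atTop_zero.comp (Real.tendsto_sqrt_atTop.comp tendsto_natCast_atTop_atTop)
    simpa using this.mul_const R
  filter_upwards [h1.eventually (gt_mem_nhds hr)] with n hn h hh
  refine hrV ?_
  rw [Metric.mem_ball, dist_eq_norm, add_sub_cancel_left, norm_smul, Real.norm_of_nonneg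
    (by positivity)]
  exact (mul_le_mul_of_nonneg_left (hR h hh) (by positivity)).trans_lt hn

/-- Each coordinate is an a.e. limit of measurable difference quotients. The index is shifted by `N`
so that every perturbed point lies in `U`, where the densities are measurable. -/
theorem aemeasurable_score (hU : IsOpen U) (hθs : θs ∈ U) (hpm : ∀ θ ∈ U, Measurable (p θ))
    (hpos : ∀ᵐ x ∂P, ∀ θ ∈ U, 0 < p θ x)
    (hscore : ∀ᵐ x ∂P, HasGradientAt (fun θ => Real.log (p θ x)) (score x) θs) :
    AEMeasurable score P := by
  have hcoord : ∀ i, AEMeasurable (fun x => score x i) P := by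
    intro i
    obtain ⟨N, hN⟩ := (eventually_forall_add_smul_mem
      (Bornology.isBounded_singleton (x := EuclideanSpace.single i (1 : ℝ)))
      (hU.mem_nhds hθs)).exists_forall_of_atTop
    have hc : Tendsto (fun n : ℕ => √((n + N : ℕ) : ℝ)) atTop atTop :=
      (Real.tendsto_sqrt_atTop.comp tendsto_natCast_atTop_atTop).comp (tendsto_add_atTop_nat N)
    refine aemeasurable_of_tendsto_metrizable_ae atTop (f := fun (n : ℕ) x => √((n + N : ℕ) : ℝ) *
      Real.log (p (θs + (1 / √((n + N : ℕ) : ℝ)) • EuclideanSpace.single i (1 : ℝ)) x / p θs x))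
      (fun n => ?_) ?_
    · exact (((hpm _ (hN (n + N) (by omega) _ rfl)).div
        (hpm θs hθs)).log.const_mul _).aemeasurable
    · filter_upwards [hpos, hscore] with x hx hsx
      have := tendsto_mul_log_ratio hU hθs hx hsx hc (EuclideanSpace.single i (1 : ℝ))
      rwa [real_inner_comm, EuclideanSpace.inner_single_left, map_one, one_mul] at this
  exact (WithLp.measurable_toLp 2 (Fin d → ℝ)).comp_aemeasurable (aemeasurable_pi_iff.2 hcoord)

end

/-! ### The linearization remainder: Lipschitz bound, mean and fluctuation. -/

/-- The remainder `√n log (p_{θ* + h/√n} / p_{θ*}) - h' ℓ̇` of the local linearization of the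
log-density. -/
def logRemainder {X : Type*} {d : ℕ} (p : Euc d → X → ℝ) (score : X → Euc d) (θs : Euc d) (n : ℕ)
    (h : Euc d) (x : X) : ℝ :=
  √(n : ℝ) * Real.log (p (θs + (1 / √(n : ℝ)) • h) x / p θs x) - inner ℝ (score x) h

section

variable {X : Type*} [MeasurableSpace X] {P : Measure X} {d : ℕ} {U : Set (Euc d)} {θs : Euc d}
  {p : Euc d → X → ℝ} {score : X → Euc d} {m : X → ℝ}

omit [MeasurableSpace X] in
-- The factor `√n` cancels the local scale `1/√n`. One `m` comes from the log-ratio, the other from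
-- the score, whose norm the Lipschitz constant bounds.
theorem abs_logRemainder_sub_le {n : ℕ} (hn : 0 < n) {x : X} (hm0 : 0 ≤ m x) (hU : IsOpen U)
    (hθs : θs ∈ U) (hpos : ∀ θ ∈ U, 0 < p θ x)
    (hs : HasGradientAt (fun θ => Real.log (p θ x)) (score x) θs)
    (hLip : ∀ θ₁ ∈ U, ∀ θ₂ ∈ U, |Real.log (p θ₁ x / p θ₂ x)| ≤ m x * ‖θ₁ - θ₂‖) {h h' : Euc d}
    (hh : θs + (1 / √(n : ℝ)) • h ∈ U) (hh' : θs + (1 / √(n : ℝ)) • h' ∈ U) :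
    |logRemainder p score θs n h x - logRemainder p score θs n h' x|
      ≤ 2 * m x * ‖h - h'‖ := by
  have hs0 : 0 < √(n : ℝ) := Real.sqrt_pos.2 (by exact_mod_cast hn)
  have h1 := norm_gradient_log_le hm0 hU hθs hpos hs hLip
  have h2 := hLip _ hh _ hh'
  rw [add_sub_add_left_eq_sub, ← smul_sub, norm_smul, Real.norm_of_nonneg (by positivity)] at h2
  have h3 : |inner ℝ (score x) (h - h')| ≤ m x * ‖h - h'‖ :=
    (abs_real_inner_le_norm _ _).trans (by gcongr)
  have h4 : logRemainder p score θs n h x - logRemainder p score θs n h' x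
      = √(n : ℝ) * Real.log (p (θs + (1 / √(n : ℝ)) • h) x / p (θs + (1 / √(n : ℝ)) • h') x)
        - inner ℝ (score x) (h - h') := by
    unfold logRemainder
    rw [Real.log_div (hpos _ hh).ne' (hpos _ hθs).ne', Real.log_div (hpos _ hh').ne'
      (hpos _ hθs).ne', Real.log_div (hpos _ hh).ne' (hpos _ hh').ne', inner_sub_right]
    ring
  rw [h4]
  refine (abs_sub _ _).trans ?_
  rw [abs_mul, abs_of_pos hs0]
  have h5 := mul_le_mul_of_nonneg_left h2 hs0.le
  have h6 : √(n : ℝ) * (m x * (1 / √(n : ℝ) * ‖h - h'‖)) = m x * ‖h - h'‖ := by field_simp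
  linarith

omit [MeasurableSpace X] in
theorem logRemainder_zero (n : ℕ) (x : X) : logRemainder p score θs n 0 x = 0 := by
  -- If the density vanishes, the ratio `0/0` is 0 and `Real.log 0 = 0`.
  by_cases h : p θs x = 0 <;> simp [logRemainder, h]

omit [MeasurableSpace X] in
theorem abs_logRemainder_le {n : ℕ} (hn : 0 < n) {x : X} (hm0 : 0 ≤ m x) (hU : IsOpen U)
    (hθs : θs ∈ U) (hpos : ∀ θ ∈ U, 0 < p θ x)
    (hs : HasGradientAt (fun θ => Real.log (p θ x)) (score x) θs)
    (hLip : ∀ θ₁ ∈ U, ∀ θ₂ ∈ U, |Real.log (p θ₁ x / p θ₂ x)| ≤ m x * ‖θ₁ - θ₂‖) {h : Euc d}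
    (hh : θs + (1 / √(n : ℝ)) • h ∈ U) :
    |logRemainder p score θs n h x| ≤ 2 * m x * ‖h‖ := by
  have := abs_logRemainder_sub_le hn hm0 hU hθs hpos hs hLip hh (h' := 0) (by simpa using hθs)
  simpa [logRemainder_zero] using this

theorem aestronglyMeasurable_logRemainder (hpm : ∀ θ ∈ U, Measurable (p θ)) (hθs : θs ∈ U)
    (hsm : AEMeasurable score P) {n : ℕ} {h : Euc d} (hh : θs + (1 / √(n : ℝ)) • h ∈ U) :
    AEStronglyMeasurable (logRemainder p score θs n h) P :=
  ((((hpm _ hh).div (hpm _ hθs)).log.const_mul _).aemeasurable.sub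
    hsm.inner_const).aestronglyMeasurable

theorem integral_logRemainder (hint : Integrable score P) {n : ℕ} {h : Euc d}
    (hl : Integrable (fun x => Real.log (p (θs + (1 / √(n : ℝ)) • h) x / p θs x)) P) :
    ∫ x, logRemainder p score θs n h x ∂P
      = √(n : ℝ) * ∫ x, Real.log (p (θs + (1 / √(n : ℝ)) • h) x / p θs x) ∂P
        - ∫ x, inner ℝ (score x) h ∂P := by
  unfold logRemainder
  rw [integral_sub (hl.const_mul _) (hint.inner_const h), integral_const_mul]

/-- Uniform quadratic expansion of the mean of the log-likelihood ratio. -/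
theorem eventually_forall_abs_integral_logRemainder_le (hU : IsOpen U) (hθs : θs ∈ U)
    (hint : Integrable score P)
    (hl : ∀ θ ∈ U, Integrable (fun x => Real.log (p θ x / p θs x)) P)
    {V : Matrix (Fin d) (Fin d) ℝ}
    (hquad : (fun θ => (∫ x, Real.log (p θ x / p θs x) ∂P)
        - (∫ x, inner ℝ (score x) (θ - θs) ∂P)
        - 1 / 2 * inner ℝ (θ - θs) (V.toEuclideanLin (θ - θs)))
      =o[𝓝 θs] fun θ => ‖θ - θs‖ ^ 2)
    {T : Set (Euc d)} (hT : Bornology.IsBounded T) {ε : ℝ} (hε : 0 < ε) :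
    ∀ᶠ n : ℕ in atTop, ∀ h ∈ T, |√(n : ℝ) * ∫ x, logRemainder p score θs n h x ∂P
      - 1 / 2 * inner ℝ h (V.toEuclideanLin h)| ≤ ε := by
  obtain ⟨R, hR0, hR⟩ := hT.exists_pos_norm_le
  -- The little-o constant `ε / R²` turns into `ε` after multiplication by `n`, as `n ‖h/√n‖² = ‖h‖²
  -- ≤ R²`.
  have hbd := hquad.bound (div_pos hε (pow_pos hR0 2))
  filter_upwards [eventually_forall_add_smul_mem hT (hU.mem_nhds hθs),
    eventually_forall_add_smul_mem hT hbd, eventually_gt_atTop 0] with n hnU hnq hn h hh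
  have hn' : (0 : ℝ) < n := by exact_mod_cast hn
  have hs0 : 0 < √(n : ℝ) := Real.sqrt_pos.2 hn'
  have hss : √(n : ℝ) * √(n : ℝ) = n := Real.mul_self_sqrt hn'.le
  have h1 := hnq h hh
  rw [add_sub_cancel_left] at h1
  rw [integral_logRemainder hint (hl _ (hnU h hh))]
  simp only [inner_smul_right, map_smul, real_inner_smul_left, integral_const_mul, norm_smul] at h1
  set I := ∫ x, Real.log (p (θs + (1 / √(n : ℝ)) • h) x / p θs x) ∂P
  set J := ∫ x, inner ℝ (score x) h ∂P
  set q := inner ℝ h (V.toEuclideanLin h)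
  have h2 : √(n : ℝ) * (√(n : ℝ) * I - J) - 1 / 2 * q
      = n * (I - 1 / √(n : ℝ) * J - 1 / 2 * (1 / √(n : ℝ) * (1 / √(n : ℝ) * q))) := by
    have hi : (n : ℝ) * (1 / √(n : ℝ)) = √(n : ℝ) := by rw [mul_one_div, Real.div_sqrt]
    have hr : √(n : ℝ) * (1 / √(n : ℝ)) = 1 := mul_one_div_cancel hs0.ne'
    linear_combination I * hss + J * hi + 1 / 2 * q * (1 / √(n : ℝ) * hi + hr)
  rw [h2, abs_mul, abs_of_pos hn']
  rw [Real.norm_eq_abs] at h1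
  refine (mul_le_mul_of_nonneg_left h1 hn'.le).trans ?_
  have h3 : ‖(‖1 / √(n : ℝ)‖ * ‖h‖) ^ 2‖ = (n : ℝ)⁻¹ * ‖h‖ ^ 2 := by
    rw [norm_pow, norm_mul, norm_norm, norm_norm, Real.norm_of_nonneg (by positivity), mul_pow,
      one_div, inv_pow, sq, hss]
  rw [h3]
  have h4 : ‖h‖ ^ 2 ≤ R ^ 2 := by gcongr; exact hR h hh
  have h5 : (n : ℝ) * (ε / R ^ 2 * ((n : ℝ)⁻¹ * ‖h‖ ^ 2)) = ε * (‖h‖ ^ 2 / R ^ 2) := by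
    field_simp
  rw [h5]
  exact mul_le_of_le_one_right hε.le ((div_le_one (by positivity)).2 h4)

/-- Centring each summand removes `n · (1/√n) = √n` times the mean of the remainder, which is added
back. The identity is algebraic in that mean, so no integrability is needed. -/
theorem sum_log_ratio_eq {n : ℕ} (hn : 0 < n) (h : Euc d) (x : Fin n → X) (q : ℝ) :
    ∑ i, Real.log (p (θs + (1 / √(n : ℝ)) • h) (x i) / p θs (x i))
      - inner ℝ h (√(n : ℝ) • ((1 / (n : ℝ)) • ∑ i, score (x i))) - q
      = empiricalFluctuation P (logRemainder p score θs n h) x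
        + (√(n : ℝ) * ∫ x, logRemainder p score θs n h x ∂P - q) := by
  have hn' : (0 : ℝ) < n := by exact_mod_cast hn
  have hs0 : 0 < √(n : ℝ) := Real.sqrt_pos.2 hn'
  have e1 : √(n : ℝ) * (1 / (n : ℝ)) = (√(n : ℝ))⁻¹ := by
    rw [mul_one_div, Real.sqrt_div_self', one_div]
  have e2 : (√(n : ℝ))⁻¹ * n = √(n : ℝ) := by
    rw [inv_mul_eq_div, Real.div_sqrt]
  rw [smul_smul, e1, inner_smul_right, inner_sum]
  unfold empiricalFluctuation
  generalize ∫ y, logRemainder p score θs n h y ∂P = I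
  unfold logRemainder
  simp only [Finset.sum_sub_distrib, Finset.sum_const, Finset.card_univ, Fintype.card_fin,
    nsmul_eq_mul, ← Finset.mul_sum, mul_sub, ← mul_assoc, inv_mul_cancel₀ hs0.ne', one_mul, e2,
    real_inner_comm h]
  ring

variable [IsProbabilityMeasure P]

/-- Chaining applies with envelope `2m`. For fixed `h` the remainder tends to 0 a.e. by
differentiability, and its square is dominated by `(2m‖h‖)²`, so second moments vanish. -/
theorem supTendstoZeroInProb_empiricalFluctuation_logRemainder (hU : IsOpen U) (hθs : θs ∈ U)
    (hpm : ∀ θ ∈ U, Measurable (p θ)) (hpos : ∀ᵐ x ∂P, ∀ θ ∈ U, 0 < p θ x)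
    (hscore : ∀ᵐ x ∂P, HasGradientAt (fun θ => Real.log (p θ x)) (score x) θs)
    (hmm : Measurable m) (hm0 : ∀ x, 0 ≤ m x) (hm : MemLp m 2 P)
    (hLip : ∀ᵐ x ∂P, ∀ θ₁ ∈ U, ∀ θ₂ ∈ U, |Real.log (p θ₁ x / p θ₂ x)| ≤ m x * ‖θ₁ - θ₂‖)
    {T : Set (Euc d)} (hT : Bornology.IsBounded T) :
    SupTendstoZeroInProb (fun n => Measure.pi fun _ : Fin n => P) T
      fun n h x => empiricalFluctuation P (logRemainder p score θs n h) x := by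
  have hsm := aemeasurable_score hU hθs hpm hpos hscore
  have hmem := eventually_forall_add_smul_mem hT (hU.mem_nhds hθs)
  have hbd : ∀ᶠ n : ℕ in atTop, ∀ h ∈ T, ∀ᵐ x ∂P,
      |logRemainder p score θs n h x| ≤ 2 * m x * ‖h‖ := by
    filter_upwards [hmem, eventually_gt_atTop 0] with n hn hn0 h hh
    filter_upwards [hpos, hscore, hLip] with x h1 h2 h3
    exact abs_logRemainder_le hn0 (hm0 x) hU hθs h1 h2 h3 (hn h hh)
  refine supTendstoZeroInProb_empiricalFluctuation (M := fun x => 2 * m x) (hmm.const_mul 2)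
    (fun x => mul_nonneg zero_le_two (hm0 x)) (hm.const_mul 2) hT _ ?_ ?_ ?_
  · filter_upwards [hmem, hbd] with n hn hb h hh
    refine MemLp.of_le ((hm.const_mul 2).mul_const ‖h‖)
      (aestronglyMeasurable_logRemainder hpm hθs hsm (hn h hh)) ?_
    filter_upwards [hb h hh] with x hx
    exact hx.trans (le_abs_self _)
  · filter_upwards [hmem, eventually_gt_atTop 0] with n hn hn0
    filter_upwards [hpos, hscore, hLip] with x h1 h2 h3 h hh h' hh'
    exact abs_logRemainder_sub_le hn0 (hm0 x) hU hθs h1 h2 h3 (hn h hh) (hn h' hh')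
  · intro h hh
    have := tendsto_integral_filter_of_dominated_convergence (μ := P) (l := atTop)
      (F := fun (n : ℕ) x => logRemainder p score θs n h x ^ 2) (f := fun _ => (0 : ℝ))
      (fun x => (2 * m x * ‖h‖) ^ 2) ?_ ?_ ((hm.const_mul 2).mul_const ‖h‖).integrable_sq ?_
    · simpa using this
    · filter_upwards [hmem] with n hn
      exact (aestronglyMeasurable_logRemainder hpm hθs hsm (hn h hh)).pow 2
    · filter_upwards [hbd] with n hb
      filter_upwards [hb h hh] with x hx
      rw [Real.norm_eq_abs, abs_pow]
      gcongr
    · filter_upwards [hpos, hscore] with x h1 h2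
      have := (tendsto_mul_log_ratio hU hθs h1 h2
        (Real.tendsto_sqrt_atTop.comp tendsto_natCast_atTop_atTop) h).sub_const
          (inner ℝ (score x) h)
      rw [sub_self] at this
      simpa [logRemainder] using this.pow 2

theorem integrable_log_ratio (hθs : θs ∈ U)
    (hpm : ∀ θ ∈ U, Measurable (p θ)) (hm : MemLp m 2 P)
    (hLip : ∀ᵐ x ∂P, ∀ θ₁ ∈ U, ∀ θ₂ ∈ U, |Real.log (p θ₁ x / p θ₂ x)| ≤ m x * ‖θ₁ - θ₂‖)
    {θ : Euc d} (hθ : θ ∈ U) : Integrable (fun x => Real.log (p θ x / p θs x)) P := by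
  refine ((hm.integrable one_le_two).mul_const ‖θ - θs‖).mono'
    (((hpm _ hθ).div (hpm _ hθs)).log).aestronglyMeasurable ?_
  filter_upwards [hLip] with x hx
  exact hx θ hθ θs hθs

theorem integrable_score (hU : IsOpen U) (hθs : θs ∈ U)
    (hpm : ∀ θ ∈ U, Measurable (p θ)) (hpos : ∀ᵐ x ∂P, ∀ θ ∈ U, 0 < p θ x)
    (hscore : ∀ᵐ x ∂P, HasGradientAt (fun θ => Real.log (p θ x)) (score x) θs)
    (hm0 : ∀ x, 0 ≤ m x) (hm : MemLp m 2 P)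
    (hLip : ∀ᵐ x ∂P, ∀ θ₁ ∈ U, ∀ θ₂ ∈ U, |Real.log (p θ₁ x / p θ₂ x)| ≤ m x * ‖θ₁ - θ₂‖) :
    Integrable score P := by
  refine (hm.integrable one_le_two).mono'
    (aemeasurable_score hU hθs hpm hpos hscore).aestronglyMeasurable ?_
  filter_upwards [hpos, hscore, hLip] with x h1 h2 h3
  exact norm_gradient_log_le (hm0 x) hU hθs h1 h2 h3

end

/-! ### The centering and the final assembly. -/

theorem Matrix.toEuclideanLin_nonsing_inv_cancel {d : ℕ} {V : Matrix (Fin d) (Fin d) ℝ}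
    (hV : IsUnit V.det) (w : Euc d) : V.toEuclideanLin (V⁻¹.toEuclideanLin w) = w := by
  ext i
  simp [Matrix.toLpLin_apply, Matrix.mulVec_mulVec, Matrix.mul_nonsing_inv _ hV]

theorem aemeasurable_centering {X L : Type*} [MeasurableSpace X] [MeasurableSpace L] {P : Measure X}
    [IsProbabilityMeasure P] {Q : Measure L} [IsProbabilityMeasure Q] {d n : ℕ} {C : L → Euc d}
    (hC : AEMeasurable C Q) {s : X → Euc d} (hs : AEMeasurable s P)
    {u : (Fin n → X) × L → Euc d}
    (hu : AEMeasurable u ((Measure.pi fun _ : Fin n => P).prod Q)) (a b c : ℝ)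
    (A : Matrix (Fin d) (Fin d) ℝ) :
    AEMeasurable (fun ω : (Fin n → X) × L => A.toEuclideanLin
      (-(a • C ω.2) + b • (c • ∑ i, s (ω.1 i)) + a • u ω))
      ((Measure.pi fun _ : Fin n => P).prod Q) := by
  have h1 : AEMeasurable (fun ω : (Fin n → X) × L => C ω.2)
      ((Measure.pi fun _ : Fin n => P).prod Q) :=
    hC.comp_quasiMeasurePreserving Measure.quasiMeasurePreserving_snd
  have h2 : AEMeasurable (fun x : Fin n → X => ∑ i, s (x i)) (Measure.pi fun _ : Fin n => P) :=
    Finset.aemeasurable_fun_sum _ fun i _ =>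
      hs.comp_quasiMeasurePreserving
        (Measure.quasiMeasurePreserving_eval (fun _ : Fin n => P) i)
  have h3 : AEMeasurable (fun ω : (Fin n → X) × L => ∑ i, s (ω.1 i))
      ((Measure.pi fun _ : Fin n => P).prod Q) :=
    h2.comp_quasiMeasurePreserving Measure.quasiMeasurePreserving_fst
  have hA : Measurable (A.toEuclideanLin : Euc d → Euc d) :=
    (LinearMap.continuous_of_finiteDimensional (A.toEuclideanLin : Euc d →ₗ[ℝ] Euc d)).measurable
  exact hA.comp_aemeasurable
    (((h1.const_smul a).neg.add ((h3.const_smul c).const_smul b)).add (hu.const_smul a))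

theorem mainTheorem6 {X : Type*} [MeasurableSpace X] (μ : Measure X) [SigmaFinite μ] {d : ℕ}
    -- the model, the true parameter `θ₀` and the point `θs` (written `θ*`) with its neighbourhood
    (Θ : Set (Euc d)) (p : Euc d → X → ℝ) (hp : IsDensityFamily μ Θ p)
    (θ₀ θs : Euc d) (hθ₀ : θ₀ ∈ Θ) (U : Set (Euc d)) (hU : IsOpen U) (hθs : θs ∈ U) (hUΘ : U ⊆ Θ)
    -- latent data with their law, and the classifier trained on the observed and latent data
    (L : ℕ → Type*) [∀ n, MeasurableSpace (L n)] (Q : ∀ n, Measure (L n))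
    [∀ n, IsProbabilityMeasure (Q n)]
    (Dhat : ∀ n, Euc d → L n → (Fin n → X) → X → ℝ)
    (hDhat : ∀ n θ l x y, Dhat n θ l x y ∈ Set.Ioo (0 : ℝ) 1)
    (hC : ∀ n, ∀ᵐ l ∂(Q n), ∀ θ ∈ U, Integrable
      (fun x => estimatedLikelihood (p θ₀) (Dhat n θ l x) x) (Measure.pi fun _ : Fin n => μ))
    -- differentiability of the log-density at `θs`
    (hpos : ∀ᵐ x ∂(densityLaw μ (p θ₀)), ∀ θ ∈ U, 0 < p θ x)
    (score : X → Euc d)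
    (hscore : ∀ᵐ x ∂(densityLaw μ (p θ₀)),
      HasGradientAt (fun θ => Real.log (p θ x)) (score x) θs)
    -- Lipschitz log-density with a square-integrable constant
    (m : X → ℝ) (hm : MemLp m 2 (densityLaw μ (p θ₀)))
    (hLip : ∀ᵐ x ∂(densityLaw μ (p θ₀)), ∀ θ₁ ∈ U, ∀ θ₂ ∈ U,
      |Real.log (p θ₁ x / p θ₂ x)| ≤ m x * ‖θ₁ - θ₂‖)
    -- second-order expansion of the expected log-likelihood ratio
    (V : Matrix (Fin d) (Fin d) ℝ) (hV : IsUnit V.det)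
    (hquad : (fun θ => (∫ x, Real.log (p θ x / p θs x) ∂(densityLaw μ (p θ₀)))
        - (∫ x, inner ℝ (score x) (θ - θs) ∂(densityLaw μ (p θ₀)))
        - 1 / 2 * inner ℝ (θ - θs) (V.toEuclideanLin (θ - θs)))
      =o[𝓝 θs] fun θ => ‖θ - θs‖ ^ 2)
    -- asymptotic linearity of the residual
    (ustar : ∀ n, (Fin n → X) × L n → Euc d)
    (hustar : ∀ n, AEMeasurable (ustar n)
      ((Measure.pi fun _ : Fin n => densityLaw μ (p θ₀)).prod (Q n)))
    (hlin : ∀ K : Set (Euc d), IsCompact K →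
      SupTendstoZeroInProb
        (fun n => (Measure.pi fun _ : Fin n => densityLaw μ (p θ₀)).prod (Q n)) K
        fun n h ω =>
          posteriorResidual (p θ₀) (p (θs + (1 / √(n : ℝ)) • h))
              (Dhat n (θs + (1 / √(n : ℝ)) • h) ω.2 ω.1) ω.1
            - posteriorResidual (p θ₀) (p θs) (Dhat n θs ω.2 ω.1) ω.1
            - 1 / √(n : ℝ) * inner ℝ h (ustar n ω))
    -- asymptotic linearity of the logarithm of the norming constant
    (Cdot : ∀ n, L n → Euc d) (hCdot : ∀ n, AEMeasurable (Cdot n) (Q n))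
    (hClin : ∀ K : Set (Euc d), IsCompact K →
      SupTendstoZeroInProb Q K fun n h l =>
        Real.log (normConst μ (p θ₀) (Dhat n (θs + (1 / √(n : ℝ)) • h) l)
            / normConst μ (p θ₀) (Dhat n θs l))
          - 1 / √(n : ℝ) * inner ℝ h (Cdot n l)) :
    MisspecifiedLAN
      (fun n => (Measure.pi fun _ : Fin n => densityLaw μ (p θ₀)).prod (Q n))
      (fun n θ ω => tiltedLikelihood μ (p θ₀) (Dhat n θ ω.2) ω.1)
      θs (fun n => 1 / √(n : ℝ)) V
      (fun n ω => V⁻¹.toEuclideanLin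
        (-((1 / √(n : ℝ)) • Cdot n ω.2)
          + √(n : ℝ) • ((1 / (n : ℝ)) • ∑ i, score (ω.1 i))
          + (1 / √(n : ℝ)) • ustar n ω)) := by
  classical
  have hP : IsProbabilityMeasure (densityLaw μ (p θ₀)) :=
    isProbabilityMeasure_densityLaw (hp.lintegral_eq_one θ₀ hθ₀)
  set P := densityLaw μ (p θ₀) with hPdef
  have hpm : ∀ θ ∈ U, Measurable (p θ) := fun θ hθ => hp.measurable θ (hUΘ hθ)
  -- The given `m` is only a.e. measurable and may be negative somewhere; the absolute value of a
  -- measurable version still dominates.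
  obtain ⟨m', hm'm, hm'0, hm', hLip'⟩ : ∃ m' : X → ℝ, Measurable m' ∧ (∀ x, 0 ≤ m' x) ∧
      MemLp m' 2 P ∧ ∀ᵐ x ∂P, ∀ θ₁ ∈ U, ∀ θ₂ ∈ U,
        |Real.log (p θ₁ x / p θ₂ x)| ≤ m' x * ‖θ₁ - θ₂‖ := by
    refine ⟨fun x => |hm.1.mk m x|, hm.1.stronglyMeasurable_mk.measurable.abs,
      fun x => abs_nonneg _, (hm.ae_eq hm.1.ae_eq_mk).abs, ?_⟩
    filter_upwards [hLip, hm.1.ae_eq_mk] with x hx he θ₁ h₁ θ₂ h₂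
    rw [← he]
    exact (hx θ₁ h₁ θ₂ h₂).trans (by gcongr; exact le_abs_self _)
  have hsm : AEMeasurable score P := aemeasurable_score hU hθs hpm hpos hscore
  have hsi : Integrable score P := integrable_score hU hθs hpm hpos hscore hm'0 hm' hLip'
  have hli : ∀ θ ∈ U, Integrable (fun x => Real.log (p θ x / p θs x)) P := fun θ hθ =>
    integrable_log_ratio hθs hpm hm' hLip' (θ := θ) hθ
  refine ⟨hV, fun n => ?_, fun K hK δ hδ => ?_⟩
  · exact aemeasurable_centering (hCdot n) hsm (hustar n) _ _ _ _
  · have hKb := hK.isBounded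
    -- Four errors share `δ`: fluctuation, residual, norming constant, and the deterministic error
    -- of the mean expansion.
    have hδ4 : 0 < δ / 4 := by positivity
    have tS := supTendstoZeroInProb_empiricalFluctuation_logRemainder hU hθs hpm hpos hscore hm'm hm'0
      hm' hLip' hKb (δ / 4) hδ4
    have tsum := (tS.add (hlin K hK (δ / 4) hδ4)).add (hClin K hK (δ / 4) hδ4)
    rw [add_zero, add_zero] at tsum
    refine tendsto_of_tendsto_of_tendsto_of_le_of_le' tendsto_const_nhds tsum
      (Eventually.of_forall fun _ => bot_le) ?_
    filter_upwards [eventually_gt_atTop 0, eventually_forall_add_smul_mem hKb (hU.mem_nhds hθs),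
      eventually_forall_abs_integral_logRemainder_le hU hθs hsi
        hli hquad hKb hδ4] with n hn hnU hnq
    set W := (Measure.pi fun _ : Fin n => P).prod (Q n)
    have hgood : ∀ᵐ ω ∂W, (∀ i, 0 < p θ₀ (ω.1 i) ∧ ∀ θ ∈ U, 0 < p θ (ω.1 i)) ∧
        ∀ θ ∈ U, 0 < normConst μ (p θ₀) (Dhat n θ ω.2) := by
      have g1 : ∀ᵐ x ∂P, 0 < p θ₀ x ∧ ∀ θ ∈ U, 0 < p θ x :=
        (ae_pos_densityLaw (hp.measurable θ₀ hθ₀)).and hpos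
      have g2 : ∀ᵐ ω ∂W, ∀ i, 0 < p θ₀ (ω.1 i) ∧ ∀ θ ∈ U, 0 < p θ (ω.1 i) :=
        Measure.quasiMeasurePreserving_fst.ae (ae_pi_forall g1)
      have g3 : ∀ᵐ ω ∂W, ∀ θ ∈ U, 0 < normConst μ (p θ₀) (Dhat n θ ω.2) := by
        have g4 : ∀ᵐ l ∂(Q n), ∀ θ ∈ U, 0 < normConst μ (p θ₀) (Dhat n θ l) :=
          (hC n).mono fun l hl θ hθ =>
            normConst_pos (hp.nonneg θ₀ hθ₀) (hp.lintegral_eq_one θ₀ hθ₀) (hl θ hθ)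
        exact Measure.quasiMeasurePreserving_snd.ae g4
      exact g2.and g3
    set A₁ : Set (Fin n → X) :=
      {x | ∃ h ∈ K, δ / 4 < |empiricalFluctuation P (logRemainder p score θs n h) x|}
    set A₂ : Set ((Fin n → X) × L n) := {ω | ∃ h ∈ K, δ / 4 <
      |posteriorResidual (p θ₀) (p (θs + (1 / √(n : ℝ)) • h))
              (Dhat n (θs + (1 / √(n : ℝ)) • h) ω.2 ω.1) ω.1
            - posteriorResidual (p θ₀) (p θs) (Dhat n θs ω.2 ω.1) ω.1
            - 1 / √(n : ℝ) * inner ℝ h (ustar n ω)|}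
    set A₃ : Set (L n) := {l | ∃ h ∈ K, δ / 4 <
      |Real.log (normConst μ (p θ₀) (Dhat n (θs + (1 / √(n : ℝ)) • h) l)
            / normConst μ (p θ₀) (Dhat n θs l)) - 1 / √(n : ℝ) * inner ℝ h (Cdot n l)|}
    -- `A₁` and `A₃` need not be measurable; the product formula holds for arbitrary sets, so it
    -- transfers outer probabilities from the factors.
    have m1 : W (A₁ ×ˢ Set.univ) = (Measure.pi fun _ : Fin n => P) A₁ := by
      rw [Measure.prod_prod, measure_univ, mul_one]
    have m3 : W (Set.univ ×ˢ A₃) = Q n A₃ := by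
      rw [Measure.prod_prod, measure_univ, one_mul]
    rw [← m1, ← m3]
    refine le_trans (measure_mono_ae ?_) ((measure_union_le _ _).trans
      (add_le_add_left (measure_union_le (A₁ ×ˢ Set.univ) A₂) (W (Set.univ ×ˢ A₃))))
    filter_upwards [hgood] with ω hω
    rintro ⟨h, hh, hlt⟩
    obtain ⟨hω1, hω2⟩ := hω
    by_contra hcon
    have hcon' : ¬ ((ω ∈ A₁ ×ˢ Set.univ ∨ ω ∈ A₂) ∨ ω ∈ Set.univ ×ˢ A₃) := hcon
    simp only [not_or] at hcon'
    obtain ⟨⟨c1, c2⟩, c3⟩ := hcon'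
    have b1 : |empiricalFluctuation P (logRemainder p score θs n h) ω.1| ≤ δ / 4 := by
      by_contra hc
      exact c1 ⟨⟨h, hh, not_le.1 hc⟩, Set.mem_univ _⟩
    have b2 := not_lt.1 fun hc => c2 ⟨h, hh, hc⟩
    have b3 := not_lt.1 fun hc => c3 ⟨Set.mem_univ _, ⟨h, hh, hc⟩⟩
    have b4 := hnq h hh
    refine absurd hlt (not_lt.2 ?_)
    rw [log_tiltedLikelihood_div (fun i => hDhat _ _ _ _ _) (fun i => hDhat _ _ _ _ _)
      (fun i => (hω1 i).1) (fun i => (hω1 i).2 _ (hnU h hh)) (fun i => (hω1 i).2 _ hθs)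
      (hω2 _ (hnU h hh)) (hω2 _ hθs), Matrix.toEuclideanLin_nonsing_inv_cancel hV]
    have e1 := sum_log_ratio_eq (P := P) (θs := θs) (p := p) (score := score) hn h ω.1
      (1 / 2 * inner ℝ h (V.toEuclideanLin h))
    rw [inner_add_right, inner_add_right, inner_neg_right, real_inner_smul_right h (Cdot n ω.2),
      real_inner_smul_right h (ustar n ω)]
    rw [abs_le] at b1 b2 b3 b4 ⊢
    constructor <;> linarith

end
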